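/- Let $n\ge 1$ and let $k=\lfloor (n-1)/2\rfloor$, so that $n=2k+1$ or $n=2k+2$. On $M=\{c=(c_1,\dots,c_n)\in\mathbb R^n : c_i>0\}$, with indices modulo $n$ (all Kronecker symbols are read modulo $n$), consider the bivector fields of the periodic Volterra lattice $$P^{ij}=c_ic_j(\delta_{i+1,j}-\delta_{j+1,i}),$$ $$Q^{ij}=c_ic_j(c_i+c_j)(\delta_{i+1,j}-\delta_{j+1,i})+c_ic_{i+1}c_{i+2}\,\delta_{i+2,j}-c_ic_{i-1}c_{i-2}\,\delta_{i-2,j},$$ with the conventions $\{f,g\}_B=\langle df,B\,dg\rangle=\sum_{i,j}B^{ij}\,\partial_if\,\partial_jg$, $(B\,df)^i=\sum_jB^{ij}\partial_jf$ and $X\wedge Z=X\otimes Z-Z\otimes X$. For $0\le i\le \lfloor n/2\rfloor$ let $\mathcal H_i=J_i/\sqrt{c_1\cdots c_n}$, where $J_i$ is the sum of the monomials $c_{l_1}\cdots c_{l_i}$ over all sets $\{l_1,\dots,l_i\}$ of $i$ sites that contain no two cyclically consecutive sites ($J_0=1$). Put $$Z_0=c_1\partial_{c_1}+c_n\partial_{c_n},\qquad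 Z=-\tfrac1{\mathcal H_0}Z_0,\qquad X=Q\,d\mathcal H_0,\qquad \widetilde Q=Q-X\wedge Z .$$ 1. $P$ and $\widetilde Q$ form a Poisson pencil on $M$: $P$ and $\widetilde Q-\nu P$, for every $\nu\in\mathbb R$, are Poisson tensors. 2. The functions $\mathcal H_i$, $0\le i\le\lfloor n/2\rfloor$, are pairwise in involution for $\{\cdot,\cdot\}_P$ and for $\{\cdot,\cdot\}_{\widetilde Q}$. 3. For every symplectic leaf $S$ of $P$ in $M$, the pencil restricts to $S$: there are brackets $\{\cdot,\cdot\}_{P|S}$ and $\{\cdot,\cdot\}_{\widetilde Q|S}$ on $C^\infty(S)$ with $\{F|_S,G|_S\}_{P|S}=\{F,G\}_P|_S$ and $\{F|_S,G|_S\}_{\widetilde Q|S}=\{F,G\}_{\widetilde Q}|_S$ for all $F,G\in C^\infty(M)$, and they form a Poisson pencil on $S$. 4. On every such $S$ the restrictions $\widehat{\mathcal H}_i=\mathcal H_i|_S$ define a bi-Lagrangian foliation: the restriction of $P$ to $S$ is nondegenerate, $\dim S=2k$, the functions $\widehat{\mathcal H}_1,\dots,\widehat{\mathcal H}_k$ are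 functionally independent on a dense open subset of $S$ and are pairwise in involution for both restricted brackets, and the remaining restrictions ($\widehat{\mathcal H}_0$ and, if $n=2k+2$, $\widehat{\mathcal H}_{k+1}$) are constant on $S$. -/

import Mathlib

open scoped ContDiff

noncomputable section

/-! ## Bivector fields and Poisson tensors on an open subset `U` of `ℝ^ι` -/

section Poisson

variable {ι : Type*} [Fintype ι] [DecidableEq ι]

/-- The partial derivative `∂F/∂c_i` at the point `c`. -/
def partialDeriv (i : ι) (F : (ι → ℝ) → ℝ) (c : ι → ℝ) : ℝ :=
  fderiv ℝ F c (Pi.single i 1)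

/-- The bracket `{F, G}_B = ⟨dF, B dG⟩ = ∑ B^{ij} ∂_i F ∂_j G` of a tensor field `B` given by its
matrix of components. -/
def bivBracket (B : (ι → ℝ) → Matrix ι ι ℝ) (F G : (ι → ℝ) → ℝ) (c : ι → ℝ) : ℝ :=
  ∑ i, ∑ j, B c i j * partialDeriv i F c * partialDeriv j G c

/-- The vector field `B dF`, with components `(B dF)^i = ∑_j B^{ij} ∂_j F`. -/
def hamField (B : (ι → ℝ) → Matrix ι ι ℝ) (F : (ι → ℝ) → ℝ) (c : ι → ℝ) : ι → ℝ :=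
  fun i => ∑ j, B c i j * partialDeriv j F c

/-- The wedge product `X ∧ Z = X ⊗ Z - Z ⊗ X` of two vector fields. -/
def wedge (X Z : (ι → ℝ) → ι → ℝ) (c : ι → ℝ) : Matrix ι ι ℝ :=
  Matrix.of fun i j => X c i * Z c j - Z c i * X c j

/-- `B` is a (smooth) Poisson tensor on the open set `U`. -/
structure IsPoissonTensor (U : Set (ι → ℝ)) (B : (ι → ℝ) → Matrix ι ι ℝ) : Prop where
  smooth : ∀ i j, ContDiffOn ℝ ∞ (fun c => B c i j) U
  antisymm : ∀ c ∈ U, ∀ i j, B c j i = -B c i j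
  jacobi : ∀ F G K : (ι → ℝ) → ℝ,
    ContDiffOn ℝ ∞ F U → ContDiffOn ℝ ∞ G U → ContDiffOn ℝ ∞ K U → ∀ c ∈ U,
      bivBracket B F (bivBracket B G K) c + bivBracket B G (bivBracket B K F) c
        + bivBracket B K (bivBracket B F G) c = 0

/-- `B₀` and `B₁` form a Poisson pencil on `U`: `B₀` and all `B₁ - ν B₀` are Poisson tensors. -/
structure IsPoissonPencilTensor (U : Set (ι → ℝ)) (B₀ B₁ : (ι → ℝ) → Matrix ι ι ℝ) : Prop where
  base : IsPoissonTensor U B₀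
  pencil : ∀ ν : ℝ, IsPoissonTensor U (fun c => B₁ c - ν • B₀ c)

/-- The points `x` and `y` of `U` are the end points of an integral curve, contained in `U`, of the
Hamiltonian vector field of a smooth function on `U`. -/
def HamiltonianStep (U : Set (ι → ℝ)) (B : (ι → ℝ) → Matrix ι ι ℝ) (x y : ι → ℝ) : Prop :=
  ∃ (F : (ι → ℝ) → ℝ) (γ : ℝ → ι → ℝ), ContDiffOn ℝ ∞ F U ∧ γ 0 = x ∧ γ 1 = y ∧
    ∀ t ∈ Set.Icc (0 : ℝ) 1, γ t ∈ U ∧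
      HasDerivWithinAt γ (hamField B F (γ t)) (Set.Icc 0 1) t

/-- `S` is a symplectic leaf of `B` in `U`: the set of all points that can be reached from some
point of `U` by finitely many integral curves of Hamiltonian vector fields. -/
def IsSymplecticLeaf (U : Set (ι → ℝ)) (B : (ι → ℝ) → Matrix ι ι ℝ) (S : Set (ι → ℝ)) : Prop :=
  ∃ x ∈ U, S = {y | Relation.ReflTransGen (HamiltonianStep U B) x y}

end Poisson

/-! ## Calculus on embedded submanifolds `S` of `ℝ^ι` -/

section Submanifold

variable {ι : Type*} [Fintype ι]

/-- `f : S → ℝ` is locally the restriction of a smooth function on an open subset of `ℝ^ι`. -/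
def IsSmoothFunction (S : Set (ι → ℝ)) (f : S → ℝ) : Prop :=
  ∀ x : S, ∃ F : (ι → ℝ) → ℝ, ∃ V : Set (ι → ℝ), IsOpen V ∧ (x : ι → ℝ) ∈ V ∧
    ContDiffOn ℝ ∞ F V ∧ ∀ y : S, (y : ι → ℝ) ∈ V → f y = F y

/-- The algebra `C^∞(S)`. -/
def smoothFunctions (S : Set (ι → ℝ)) : Subalgebra ℝ (S → ℝ) where
  carrier := {f | IsSmoothFunction S f}
  mul_mem' := by
    intro f g hf hg x
    obtain ⟨F, V, hV, hxV, hF, hfF⟩ := hf x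
    obtain ⟨G, W, hW, hxW, hG, hgG⟩ := hg x
    exact ⟨fun y => F y * G y, V ∩ W, hV.inter hW, ⟨hxV, hxW⟩,
      (hF.mono Set.inter_subset_left).mul (hG.mono Set.inter_subset_right),
      fun y hy => by simp [hfF y hy.1, hgG y hy.2]⟩
  add_mem' := by
    intro f g hf hg x
    obtain ⟨F, V, hV, hxV, hF, hfF⟩ := hf x
    obtain ⟨G, W, hW, hxW, hG, hgG⟩ := hg x
    exact ⟨fun y => F y + G y, V ∩ W, hV.inter hW, ⟨hxV, hxW⟩,
      (hF.mono Set.inter_subset_left).add (hG.mono Set.inter_subset_right),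
      fun y hy => by simp [hfF y hy.1, hgG y hy.2]⟩
  algebraMap_mem' := by
    intro r x
    exact ⟨fun _ => r, Set.univ, isOpen_univ, Set.mem_univ _, contDiffOn_const, fun y _ => rfl⟩

/-- The tangent space `T_x S`, spanned by the velocities at `x` of the smooth curves in `S`. -/
def tangentSpace (S : Set (ι → ℝ)) (x : ι → ℝ) : Submodule ℝ (ι → ℝ) :=
  Submodule.span ℝ {v | ∃ γ : ℝ → ι → ℝ, ContDiff ℝ ∞ γ ∧ (∀ t, γ t ∈ S) ∧ γ 0 = x ∧ deriv γ 0 = v}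

/-- The differential at `x` of `f ∈ C^∞(S)`, as a linear form on `T_x S`: the restriction to
`T_x S` of the derivative of any smooth local extension of `f`. -/
def differential {S : Set (ι → ℝ)} (f : smoothFunctions S) (x : S) :
    tangentSpace S x →ₗ[ℝ] ℝ :=
  ((fderiv ℝ (f.2 x).choose x : (ι → ℝ) →L[ℝ] ℝ) : (ι → ℝ) →ₗ[ℝ] ℝ).domRestrict (tangentSpace S x)

/-- The differential does not depend on the chosen extension. -/
theorem differential_eq {S : Set (ι → ℝ)} (f : smoothFunctions S) (x : S)
    (F : (ι → ℝ) → ℝ) (V : Set (ι → ℝ)) (hV : IsOpen V) (hx : (x : ι → ℝ) ∈ V)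
    (hF : ContDiffOn ℝ ∞ F V) (hf : ∀ y : S, (y : ι → ℝ) ∈ V → (f : S → ℝ) y = F y)
    (v : tangentSpace S x) :
    differential f x v = fderiv ℝ F x v := by
  obtain ⟨W, hW, hxW, hG, hfG⟩ := (f.2 x).choose_spec
  obtain ⟨v, hv⟩ := v
  change fderiv ℝ (f.2 x).choose x v = fderiv ℝ F x v
  set G := (f.2 x).choose
  have key : ∀ (K : (ι → ℝ) → ℝ) (O : Set (ι → ℝ)), IsOpen O → (x : ι → ℝ) ∈ O →
      ContDiffOn ℝ ∞ K O → HasFDerivAt K (fderiv ℝ K x) x := fun K O hO hxO hK =>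
    ((hK.contDiffAt (hO.mem_nhds hxO)).differentiableAt (by simp)).hasFDerivAt
  induction hv using Submodule.span_induction with
  | mem v hv =>
    obtain ⟨γ, hγ, hγS, hγ0, rfl⟩ := hv
    have hd : HasDerivAt γ (deriv γ 0) 0 := (hγ.differentiable (by simp) 0).hasDerivAt
    have h1 := (hγ0 ▸ key G W hW hxW hG : HasFDerivAt G (fderiv ℝ G x) (γ 0)).comp_hasDerivAt 0 hd
    have h2 := (hγ0 ▸ key F V hV hx hF : HasFDerivAt F (fderiv ℝ F x) (γ 0)).comp_hasDerivAt 0 hd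
    refine h1.unique (h2.congr_of_eventuallyEq ?_)
    have hn : γ ⁻¹' (V ∩ W) ∈ nhds (0 : ℝ) :=
      hγ.continuous.continuousAt.preimage_mem_nhds
        (by rw [hγ0]; exact (hV.inter hW).mem_nhds ⟨hx, hxW⟩)
    filter_upwards [hn] with t ht
    exact (hfG ⟨γ t, hγS t⟩ ht.2).symm.trans (hf ⟨γ t, hγS t⟩ ht.1)
  | zero => simp
  | add v w _ _ hv hw => simp [hv, hw]
  | smul a v _ hv => simp [hv]

end Submanifold

/-! ## Poisson brackets, restriction, bi-Lagrangian foliations -/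

section Restriction

/-- A Poisson bracket on a commutative real algebra. -/
structure IsPoissonBracket {A : Type*} [CommRing A] [Algebra ℝ A] (br : A →ₗ[ℝ] A →ₗ[ℝ] A) :
    Prop where
  self : ∀ f, br f f = 0
  leibniz : ∀ f g h, br f (g * h) = br f g * h + g * br f h
  jacobi : ∀ f g h, br f (br g h) + br g (br h f) + br h (br f g) = 0

/-- Two brackets form a Poisson pencil: `br₀` and all `br₁ - ν br₀` are Poisson brackets. -/
structure IsPoissonPencil {A : Type*} [CommRing A] [Algebra ℝ A] (br₀ br₁ : A →ₗ[ℝ] A →ₗ[ℝ] A) :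
    Prop where
  base : IsPoissonBracket br₀
  pencil : ∀ ν : ℝ, IsPoissonBracket (br₁ - ν • br₀)

variable {ι : Type*} [Fintype ι] [DecidableEq ι]

/-- The tensor field `B` on `U` restricts to `S ⊆ U`, with restriction the bracket `br` on
`C^∞(S)`: for all smooth functions on `U`, `{F|_S, G|_S}_br = {F, G}_B|_S`. -/
def RestrictsTo (U : Set (ι → ℝ)) (B : (ι → ℝ) → Matrix ι ι ℝ) (S : Set (ι → ℝ))
    (br : smoothFunctions S →ₗ[ℝ] smoothFunctions S →ₗ[ℝ] smoothFunctions S) : Prop :=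
  S ⊆ U ∧ ∀ F G : (ι → ℝ) → ℝ, ContDiffOn ℝ ∞ F U → ContDiffOn ℝ ∞ G U →
    ∀ f g : smoothFunctions S, (∀ x : S, (f : S → ℝ) x = F x) → (∀ x : S, (g : S → ℝ) x = G x) →
      ∀ x : S, (br f g : S → ℝ) x = bivBracket B F G x

/-- The bracket `br` on `C^∞(S)` is nondegenerate, i.e. comes from a symplectic form. -/
def IsNondegenerate {S : Set (ι → ℝ)}
    (br : smoothFunctions S →ₗ[ℝ] smoothFunctions S →ₗ[ℝ] smoothFunctions S) : Prop :=
  ∀ (x : S) (f : smoothFunctions S), (∀ g, (br f g : S → ℝ) x = 0) → differential f x = 0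

/-- The functions `f₁, …, f_k` define a bi-Lagrangian foliation of `S`, where `br₀` is symplectic
and `br₁` is a second bracket: `k` is half the dimension of `S`, the functions are functionally
independent (on a dense open set) and they are in involution for both brackets. -/
structure IsBiLagrangianFoliation {S : Set (ι → ℝ)}
    (br₀ br₁ : smoothFunctions S →ₗ[ℝ] smoothFunctions S →ₗ[ℝ] smoothFunctions S)
    {k : ℕ} (f : Fin k → smoothFunctions S) : Prop where
  symplectic : IsNondegenerate br₀
  dim : ∀ x : S, Module.finrank ℝ (tangentSpace S x) = 2 * k
  independent : ∃ W : Set S, IsOpen W ∧ Dense W ∧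
    ∀ x ∈ W, LinearIndependent ℝ fun i => differential (f i) x
  involution₀ : ∀ i j, br₀ (f i) (f j) = 0
  involution₁ : ∀ i j, br₁ (f i) (f j) = 0

end Restriction

/-! ## The Volterra lattice

The sites are indexed by `ZMod n`, so that `c_{i+n} = c_i`; the site `n` is `0 : ZMod n`. -/

section Volterra

variable (n : ℕ) [NeZero n]

/-- The phase space: all `c_i > 0`. -/
def phaseSpace : Set (ZMod n → ℝ) := {c | ∀ i, 0 < c i}

/-- The Kronecker symbol. -/
def kron (i j : ZMod n) : ℝ := if i = j then 1 else 0

/-- The quadratic Poisson tensor. -/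
def tensorP (c : ZMod n → ℝ) : Matrix (ZMod n) (ZMod n) ℝ :=
  Matrix.of fun i j => c i * c j * (kron n (i + 1) j - kron n (j + 1) i)

/-- The cubic Poisson tensor. -/
def tensorQ (c : ZMod n → ℝ) : Matrix (ZMod n) (ZMod n) ℝ :=
  Matrix.of fun i j => c i * c j * (c i + c j) * (kron n (i + 1) j - kron n (j + 1) i)
    + c i * c (i + 1) * c (i + 2) * kron n (i + 2) j
    - c i * c (i - 1) * c (i - 2) * kron n (i - 2) j

/-- `J_i`: the sum of the monomials `∏_{l ∈ s} c_l` over the sets `s` of `i` sites that are totally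
disconnected, i.e. contain no two cyclically consecutive sites. -/
def volterraJ (i : ℕ) (c : ZMod n → ℝ) : ℝ :=
  ∑ s ∈ (Finset.univ.powersetCard i : Finset (Finset (ZMod n))) with ∀ l ∈ s, l + 1 ∉ s,
    ∏ l ∈ s, c l

/-- The Hamiltonians `𝓗_i = J_i / π`, where `π = (∏ c_l)^{1/2}`. -/
def volterraH (i : ℕ) (c : ZMod n → ℝ) : ℝ :=
  volterraJ n i c / Real.sqrt (∏ l, c l)

/-- `Z₀ = c_1 ∂_{c_1} + c_n ∂_{c_n}`. -/
def fieldZ₀ (c : ZMod n → ℝ) : ZMod n → ℝ :=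
  c 1 • Pi.single 1 1 + c 0 • Pi.single 0 1

/-- `Z = -(1/𝓗_0) Z₀`. -/
def fieldZ (c : ZMod n → ℝ) : ZMod n → ℝ :=
  -(1 / volterraH n 0 c) • fieldZ₀ n c

/-- `X = Q d𝓗_0`. -/
def fieldX : (ZMod n → ℝ) → ZMod n → ℝ :=
  hamField (tensorQ n) (volterraH n 0)

/-- The deformed tensor `Q̃ = Q - X ∧ Z`, where `(Q dF)^i = ∑_j Q^{ij} ∂_j F` and
`X ∧ Z = X ⊗ Z - Z ⊗ X`. -/
def tensorQdef (c : ZMod n → ℝ) : Matrix (ZMod n) (ZMod n) ℝ :=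
  tensorQ n c - wedge (fieldX n) (fieldZ n) c

end Volterra

end

/-!
The tensors are best written in the frame of the commuting vector fields `D_i = c_i ∂_{c_i}`, i.e.
in the logarithmic coordinates `log c_i`. Put `E_m = D_{m-1} + D_m`. Then `P = ∑ D_i ∧ D_{i+1}` has
constant coefficients and `Q = ∑ c_m E_m ∧ E_{m+1}`. Since `E_m log 𝓗_0 = -1` for all `m`, the
deformation by `X ∧ Z` subtracts `E_1` from all these fields (`tensorQdef_apply`):
`Q̃ = ∑ c_m (E_m - E_1) ∧ (E_{m+1} - E_1)`.

For such tensors the Jacobi identity is an identity between constant trivectors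
(`isPoissonTensor_of_logLinear`). It holds for `Q̃ - ν P` because `P d log c_m = E_m - E_{m+1}`,
which kills `[P, Q̃]` term by term, and because the contribution of `E_1` to `[Q̃, Q̃]` involves
only the bivectors with `m = 0, 1`, which vanish.

Involutivity comes from the Lenard recursion `Q d𝓗_i = -P d𝓗_{i+1}`
(`hamField_tensorQ_volterraH`), a counting identity for totally disconnected sets, starting at
`P d𝓗_0 = 0`. The correction `X ∧ Z` does not contribute, since `X 𝓗_i = {𝓗_i, 𝓗_0}_Q = 0`.

A symplectic leaf of `P` is an affine subspace in logarithmic coordinates, with the range of the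
constant map `P` as its direction. It is therefore a smooth retract of the phase space, and both
tensors are tangent to it, as `E_m - E_1` lies in that range; composing with the retraction
restricts the pencil to the leaf (`retractBracket`). The dimension of the leaf and the Casimir
functions are read off from the kernel of the constant map.

For the functional independence, consider the derivatives of `J_1, …, J_k` along the tangent fields
`D_{2j-1} - D_{2j+1}`. From any point of a leaf there is a curve in the leaf, a line in logarithmic
coordinates, along which `J_i` is asymptotic to the single monomial `c_1 c_3 ⋯ c_{2i-1}`, so that
the matrix of the derivatives, with its rows rescaled, tends to a nonsingular diagonal one
(`exists_det_oddMinor_ne_zero`). Its determinant is analytic along the curve, so it is nonzero at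
points arbitrarily close to the starting point.
-/

set_option linter.unusedSectionVars false

noncomputable section

/-! ### Partial derivatives and brackets of smooth functions -/

section General

variable {ι : Type*} [Fintype ι] [DecidableEq ι]

theorem fderiv_eq_sum_partialDeriv (F : (ι → ℝ) → ℝ) (c v : ι → ℝ) :
    fderiv ℝ F c v = ∑ i, v i * partialDeriv i F c := by
  conv_lhs => rw [pi_eq_sum_univ' v]
  simp [partialDeriv, map_sum]

theorem bivBracket_eq_fderiv (B : (ι → ℝ) → Matrix ι ι ℝ) (F G : (ι → ℝ) → ℝ) (c : ι → ℝ) :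
    bivBracket B F G c = fderiv ℝ F c (hamField B G c) := by
  rw [fderiv_eq_sum_partialDeriv]
  simp only [bivBracket, hamField, Finset.sum_mul]
  exact Finset.sum_congr rfl fun i _ => Finset.sum_congr rfl fun j _ => by ring

theorem bivBracket_antisymm {B : (ι → ℝ) → Matrix ι ι ℝ} {c : ι → ℝ}
    (hB : ∀ i j, B c j i = -B c i j) (F G : (ι → ℝ) → ℝ) :
    bivBracket B F G c = -bivBracket B G F c := by
  unfold bivBracket
  rw [Finset.sum_comm, ← Finset.sum_neg_distrib]
  refine Finset.sum_congr rfl fun i _ => ?_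
  rw [← Finset.sum_neg_distrib]
  exact Finset.sum_congr rfl fun j _ => by rw [hB i j]; ring

variable {U : Set (ι → ℝ)} {F G : (ι → ℝ) → ℝ} {c : ι → ℝ}

theorem ContDiffOn.differentiableAt_of_isOpen (hU : IsOpen U) (hF : ContDiffOn ℝ ∞ F U)
    (hc : c ∈ U) : DifferentiableAt ℝ F c :=
  (hF.contDiffAt (hU.mem_nhds hc)).differentiableAt (by simp)

theorem contDiffOn_partialDeriv (hU : IsOpen U) (hF : ContDiffOn ℝ ∞ F U) (i : ι) :
    ContDiffOn ℝ ∞ (partialDeriv i F) U :=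
  (hF.fderiv_of_isOpen hU (by simp)).clm_apply contDiffOn_const

theorem contDiffOn_bivBracket (hU : IsOpen U) {B : (ι → ℝ) → Matrix ι ι ℝ}
    (hB : ∀ i j, ContDiffOn ℝ ∞ (fun c => B c i j) U)
    (hF : ContDiffOn ℝ ∞ F U) (hG : ContDiffOn ℝ ∞ G U) :
    ContDiffOn ℝ ∞ (bivBracket B F G) U :=
  ContDiffOn.sum fun i _ => ContDiffOn.sum fun j _ =>
    ((hB i j).mul (contDiffOn_partialDeriv hU hF i)).mul (contDiffOn_partialDeriv hU hG j)

theorem partialDeriv_add (hF : DifferentiableAt ℝ F c) (hG : DifferentiableAt ℝ G c) (i : ι) :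
    partialDeriv i (fun x => F x + G x) c = partialDeriv i F c + partialDeriv i G c := by
  simp only [partialDeriv]
  rw [fderiv_fun_add hF hG]; rfl

theorem partialDeriv_sum {κ : Type*} (s : Finset κ) {A : κ → (ι → ℝ) → ℝ}
    (hA : ∀ k ∈ s, DifferentiableAt ℝ (A k) c) (i : ι) :
    partialDeriv i (fun x => ∑ k ∈ s, A k x) c = ∑ k ∈ s, partialDeriv i (A k) c := by
  simp only [partialDeriv]
  rw [fderiv_fun_sum hA]; simp

theorem partialDeriv_mul (hF : DifferentiableAt ℝ F c) (hG : DifferentiableAt ℝ G c) (i : ι) :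
    partialDeriv i (fun x => F x * G x) c
      = partialDeriv i F c * G c + F c * partialDeriv i G c := by
  simp only [partialDeriv]
  rw [fderiv_fun_mul hF hG]; simp; ring

theorem partialDeriv_const_mul (hF : DifferentiableAt ℝ F c) (a : ℝ) (i : ι) :
    partialDeriv i (fun x => a * F x) c = a * partialDeriv i F c := by
  simp only [partialDeriv]
  rw [fderiv_const_mul hF]; simp

theorem partialDeriv_congr (h : F =ᶠ[nhds c] G) (i : ι) :
    partialDeriv i F c = partialDeriv i G c := by
  simp only [partialDeriv, h.fderiv_eq]

theorem partialDeriv_comm (hU : IsOpen U) (hF : ContDiffOn ℝ ∞ F U) (hc : c ∈ U) (i j : ι) :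
    partialDeriv i (partialDeriv j F) c = partialDeriv j (partialDeriv i F) c := by
  have hsm := hF.contDiffAt (hU.mem_nhds hc)
  have hsym : IsSymmSndFDerivAt ℝ F c := hsm.isSymmSndFDerivAt
    (by simp only [minSmoothness_of_isRCLikeNormedField]; exact WithTop.coe_le_coe.2 le_top)
  have hd : DifferentiableAt ℝ (fderiv ℝ F) c :=
    ((hF.fderiv_of_isOpen hU (m := ∞) (by simp)).contDiffAt (hU.mem_nhds hc)).differentiableAt
      (by simp)
  have key : ∀ v w : ι → ℝ,
      fderiv ℝ (fun x => fderiv ℝ F x w) c v = fderiv ℝ (fderiv ℝ F) c v w := by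
    intro v w
    rw [fderiv_clm_apply hd (by fun_prop)]
    simp
  change fderiv ℝ (fun x => fderiv ℝ F x (Pi.single j 1)) c (Pi.single i 1)
    = fderiv ℝ (fun x => fderiv ℝ F x (Pi.single i 1)) c (Pi.single j 1)
  rw [key, key]
  exact hsym.eq _ _

theorem bivBracket_mul_right (B : (ι → ℝ) → Matrix ι ι ℝ) {K : (ι → ℝ) → ℝ}
    (hG : DifferentiableAt ℝ G c) (hK : DifferentiableAt ℝ K c) :
    bivBracket B F (fun x => G x * K x) c
      = bivBracket B F G c * K c + G c * bivBracket B F K c := by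
  simp only [bivBracket, partialDeriv_mul hG hK, Finset.sum_mul, Finset.mul_sum,
    ← Finset.sum_add_distrib]
  exact Finset.sum_congr rfl fun i _ => Finset.sum_congr rfl fun j _ => by ring

theorem partialDeriv_bivBracket (hU : IsOpen U) {B : (ι → ℝ) → Matrix ι ι ℝ}
    (hB : ∀ i j, ContDiffOn ℝ ∞ (fun c => B c i j) U)
    (hF : ContDiffOn ℝ ∞ F U) (hG : ContDiffOn ℝ ∞ G U) (hc : c ∈ U) (l : ι) :
    partialDeriv l (bivBracket B F G) c = ∑ i, ∑ j,
      (partialDeriv l (fun x => B x i j) c * partialDeriv i F c * partialDeriv j G c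
        + B c i j * partialDeriv l (partialDeriv i F) c * partialDeriv j G c
        + B c i j * partialDeriv i F c * partialDeriv l (partialDeriv j G) c) := by
  have hb := fun i j => (hB i j).differentiableAt_of_isOpen hU hc
  have hf := fun i => (contDiffOn_partialDeriv hU hF i).differentiableAt_of_isOpen hU hc
  have hg := fun i => (contDiffOn_partialDeriv hU hG i).differentiableAt_of_isOpen hU hc
  unfold bivBracket
  rw [partialDeriv_sum]
  · refine Finset.sum_congr rfl fun i _ => ?_
    rw [partialDeriv_sum]
    · refine Finset.sum_congr rfl fun j _ => ?_
      rw [partialDeriv_mul ((hb i j).fun_mul (hf i)) (hg j), partialDeriv_mul (hb i j) (hf i)]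
      ring
    · exact fun j _ => ((hb i j).mul (hf i)).mul (hg j)
  · exact fun i _ => DifferentiableAt.fun_sum fun j _ => ((hb i j).mul (hf i)).mul (hg j)

open Matrix in
/-- The algebra behind the Jacobi identity: `f`, `g`, `h` are the gradients of three functions,
`F₂`, `G₂`, `H₂` their Hessians, and `D l` is the derivative of `B` in the direction `l`. The
Hessian terms cancel in pairs because `B` is antisymmetric. -/
theorem jacobi_algebra (B : Matrix ι ι ℝ) (D : ι → Matrix ι ι ℝ) (hB : ∀ i j, B j i = -B i j)
    (f g h : ι → ℝ) (F₂ G₂ H₂ : Matrix ι ι ℝ) (hF : ∀ i j, F₂ i j = F₂ j i)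
    (hG : ∀ i j, G₂ i j = G₂ j i) (hH : ∀ i j, H₂ i j = H₂ j i)
    (hD : ∀ i j k, ∑ l, (B i l * D l j k + B j l * D l k i + B k l * D l i j) = 0) :
    ∑ a, ∑ l, B a l * f a * (∑ i, ∑ j,
        (D l i j * g i * h j + B i j * G₂ l i * h j + B i j * g i * H₂ l j))
      + ∑ a, ∑ l, B a l * g a * (∑ i, ∑ j,
        (D l i j * h i * f j + B i j * H₂ l i * f j + B i j * h i * F₂ l j))
      + ∑ a, ∑ l, B a l * h a * (∑ i, ∑ j,
        (D l i j * f i * g j + B i j * F₂ l i * g j + B i j * f i * G₂ l j)) = 0 := by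
  have hBT : Bᵀ = -B := by ext i j; simpa using hB i j
  have split : ∀ (f g h : ι → ℝ) (G₂ H₂ : Matrix ι ι ℝ),
      ∑ a, ∑ l, B a l * f a * (∑ i, ∑ j,
        (D l i j * g i * h j + B i j * G₂ l i * h j + B i j * g i * H₂ l j))
      = (∑ a, ∑ i, ∑ j, (∑ l, B a l * D l i j) * (f a * g i * h j))
        + (f ᵥ* B) ⬝ᵥ (G₂ *ᵥ (B *ᵥ h)) + (f ᵥ* B) ⬝ᵥ (H₂ *ᵥ (g ᵥ* B)) := by
    intro f g h G₂ H₂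
    have e0 : ∀ X : ι → ℝ, ∑ a, ∑ l, B a l * f a * X l = (f ᵥ* B) ⬝ᵥ X := by
      intro X
      simp only [dotProduct, vecMul, Finset.sum_mul]
      rw [Finset.sum_comm]
      exact Finset.sum_congr rfl fun l _ => Finset.sum_congr rfl fun a _ => by ring
    have e1 : (fun l => ∑ i, ∑ j,
        (D l i j * g i * h j + B i j * G₂ l i * h j + B i j * g i * H₂ l j))
        = (fun l => ∑ i, ∑ j, D l i j * g i * h j) + G₂ *ᵥ (B *ᵥ h) + H₂ *ᵥ (g ᵥ* B) := by
      funext l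
      simp only [Pi.add_apply, dotProduct, vecMul, mulVec, Finset.mul_sum, Finset.sum_add_distrib]
      congr 1
      · congr 1
        exact Finset.sum_congr rfl fun i _ => Finset.sum_congr rfl fun j _ => by ring
      · rw [Finset.sum_comm]
        exact Finset.sum_congr rfl fun i _ => Finset.sum_congr rfl fun j _ => by ring
    have e2 : (f ᵥ* B) ⬝ᵥ (fun l => ∑ i, ∑ j, D l i j * g i * h j)
        = ∑ a, ∑ i, ∑ j, (∑ l, B a l * D l i j) * (f a * g i * h j) := by
      rw [← e0]
      refine Finset.sum_congr rfl fun a _ => ?_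
      simp only [Finset.sum_mul, Finset.mul_sum]
      rw [Finset.sum_comm]
      refine Finset.sum_congr rfl fun i _ => ?_
      rw [Finset.sum_comm]
      exact Finset.sum_congr rfl fun j _ => Finset.sum_congr rfl fun l _ => by ring
    rw [e0 (fun l => ∑ i, ∑ j,
      (D l i j * g i * h j + B i j * G₂ l i * h j + B i j * g i * H₂ l j)), e1,
      dotProduct_add, dotProduct_add, e2]
  have quad : ∀ (f g : ι → ℝ) (A : Matrix ι ι ℝ), (∀ i j, A i j = A j i) →
      (f ᵥ* B) ⬝ᵥ (A *ᵥ (B *ᵥ g)) + (g ᵥ* B) ⬝ᵥ (A *ᵥ (f ᵥ* B)) = 0 := by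
    intro f g A hA
    have hAT : Aᵀ = A := by ext i j; exact hA j i
    have hg : g ᵥ* B = -(B *ᵥ g) := by
      rw [← mulVec_transpose, hBT, neg_mulVec]
    rw [hg, dotProduct_mulVec, ← mulVec_transpose, hAT, dotProduct_comm, neg_dotProduct]
    simp
  rw [split, split, split]
  have h1 := quad f h G₂ hG
  have h2 := quad g f H₂ hH
  have h3 := quad h g F₂ hF
  have main : (∑ a, ∑ i, ∑ j, (∑ l, B a l * D l i j) * (f a * g i * h j))
      + (∑ a, ∑ i, ∑ j, (∑ l, B a l * D l i j) * (g a * h i * f j))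
      + (∑ a, ∑ i, ∑ j, (∑ l, B a l * D l i j) * (h a * f i * g j)) = 0 := by
    have r1 : (∑ a, ∑ i, ∑ j, (∑ l, B a l * D l i j) * (g a * h i * f j))
        = ∑ a, ∑ i, ∑ j, (∑ l, B i l * D l j a) * (f a * g i * h j) := by
      symm
      rw [Finset.sum_comm]
      refine Finset.sum_congr rfl fun a _ => ?_
      rw [Finset.sum_comm]
      exact Finset.sum_congr rfl fun i _ => Finset.sum_congr rfl fun j _ => by ring
    have r2 : (∑ a, ∑ i, ∑ j, (∑ l, B a l * D l i j) * (h a * f i * g j))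
        = ∑ a, ∑ i, ∑ j, (∑ l, B j l * D l a i) * (f a * g i * h j) := by
      rw [Finset.sum_comm]
      refine Finset.sum_congr rfl fun a _ => ?_
      rw [Finset.sum_comm]
      exact Finset.sum_congr rfl fun i _ => Finset.sum_congr rfl fun j _ => by ring
    rw [r1, r2, ← Finset.sum_add_distrib, ← Finset.sum_add_distrib]
    refine Finset.sum_eq_zero fun a _ => ?_
    rw [← Finset.sum_add_distrib, ← Finset.sum_add_distrib]
    refine Finset.sum_eq_zero fun i _ => ?_
    rw [← Finset.sum_add_distrib, ← Finset.sum_add_distrib]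
    refine Finset.sum_eq_zero fun j _ => ?_
    rw [← add_mul, ← add_mul, ← Finset.sum_add_distrib, ← Finset.sum_add_distrib, hD, zero_mul]
  linarith

/-- A smooth antisymmetric tensor field is Poisson as soon as the Jacobi identity holds in
components, i.e. for the coordinate functions. -/
theorem isPoissonTensor_of_components (hU : IsOpen U) {B : (ι → ℝ) → Matrix ι ι ℝ}
    (hB : ∀ i j, ContDiffOn ℝ ∞ (fun c => B c i j) U)
    (hanti : ∀ c ∈ U, ∀ i j, B c j i = -B c i j)
    (hjac : ∀ c ∈ U, ∀ i j k, ∑ l, (B c i l * partialDeriv l (fun x => B x j k) c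
      + B c j l * partialDeriv l (fun x => B x k i) c
      + B c k l * partialDeriv l (fun x => B x i j) c) = 0) :
    IsPoissonTensor U B := by
  refine ⟨hB, hanti, fun F G K hF hG hK c hc => ?_⟩
  have key : ∀ F G K : (ι → ℝ) → ℝ, ContDiffOn ℝ ∞ G U → ContDiffOn ℝ ∞ K U →
      bivBracket B F (bivBracket B G K) c = ∑ a, ∑ l, B c a l * partialDeriv a F c * (∑ i, ∑ j,
        (partialDeriv l (fun x => B x i j) c * partialDeriv i G c * partialDeriv j K c
        + B c i j * partialDeriv l (partialDeriv i G) c * partialDeriv j K c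
        + B c i j * partialDeriv i G c * partialDeriv l (partialDeriv j K) c)) := by
    intro F G K hG hK
    refine Finset.sum_congr rfl fun a _ => Finset.sum_congr rfl fun l _ => ?_
    rw [partialDeriv_bivBracket hU hB hG hK hc]
  rw [key F G K hG hK, key G K F hK hF, key K F G hF hG]
  exact jacobi_algebra (B c) (fun l => Matrix.of fun i j => partialDeriv l (fun x => B x i j) c)
    (hanti c hc) (fun i => partialDeriv i F c) (fun i => partialDeriv i G c)
    (fun i => partialDeriv i K c) (Matrix.of fun i j => partialDeriv i (partialDeriv j F) c)
    (Matrix.of fun i j => partialDeriv i (partialDeriv j G) c)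
    (Matrix.of fun i j => partialDeriv i (partialDeriv j K) c)
    (partialDeriv_comm hU hF hc) (partialDeriv_comm hU hG hc) (partialDeriv_comm hU hK hc)
    (hjac c hc)

end General

/-! ### Restriction of a Poisson tensor to a smooth retract -/

section Retract

variable {ι : Type*} [Fintype ι]

/-- `ρ` is a smooth retraction of the open set `U` onto its subset `S`. -/
structure IsSmoothRetraction (U S : Set (ι → ℝ)) (ρ : (ι → ℝ) → ι → ℝ) : Prop where
  isOpen : IsOpen U
  subset : S ⊆ U
  smooth : ContDiffOn ℝ ∞ ρ U
  mem : ∀ c ∈ U, ρ c ∈ S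
  fix : ∀ c ∈ S, ρ c = c

/-- The restriction to `S` of a function that is smooth on an open set containing `S`. -/
def restrictSmooth {U S : Set (ι → ℝ)} (hU : IsOpen U) (hS : S ⊆ U) {F : (ι → ℝ) → ℝ}
    (hF : ContDiffOn ℝ ∞ F U) : smoothFunctions S :=
  ⟨fun x => F x, fun x => ⟨F, U, hU, hS x.2, hF, fun _ _ => rfl⟩⟩

/-- The extension `f ∘ ρ` of a function `f` on `S`; it takes the junk value `0` where `ρ` leaves
`S`, which does not happen on the domain of a retraction. -/
def extendBy {S : Set (ι → ℝ)} (ρ : (ι → ℝ) → ι → ℝ) (f : S → ℝ) (c : ι → ℝ) : ℝ :=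
  Function.extend Subtype.val f 0 (ρ c)

variable {U S : Set (ι → ℝ)} {ρ : (ι → ℝ) → ι → ℝ}

theorem extendBy_of_mem (f : S → ℝ) {c : ι → ℝ} (h : ρ c ∈ S) :
    extendBy ρ f c = f ⟨ρ c, h⟩ :=
  Subtype.val_injective.extend_apply f 0 ⟨ρ c, h⟩

theorem IsSmoothRetraction.extendBy_apply (hρ : IsSmoothRetraction U S ρ) (f : S → ℝ) (x : S) :
    extendBy ρ f x = f x := by
  rw [extendBy_of_mem f (hρ.mem x (hρ.subset x.2))]
  exact congrArg f (Subtype.ext (hρ.fix x x.2))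

theorem IsSmoothRetraction.contDiffOn_extendBy (hρ : IsSmoothRetraction U S ρ)
    (f : smoothFunctions S) : ContDiffOn ℝ ∞ (extendBy ρ (f : S → ℝ)) U := by
  intro c hc
  obtain ⟨F, V, hV, hcV, hF, hfF⟩ := f.2 ⟨ρ c, hρ.mem c hc⟩
  have hρc : ContDiffAt ℝ ∞ ρ c := hρ.smooth.contDiffAt (hρ.isOpen.mem_nhds hc)
  have h1 : ContDiffAt ℝ ∞ (fun y => F (ρ y)) c :=
    ContDiffAt.comp c (hF.contDiffAt (hV.mem_nhds hcV)) hρc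
  refine (h1.congr_of_eventuallyEq ?_).contDiffWithinAt
  filter_upwards [hρ.isOpen.mem_nhds hc,
    hρc.continuousAt.preimage_mem_nhds (hV.mem_nhds hcV)] with y hy hyV
  rw [extendBy_of_mem _ (hρ.mem y hy)]
  exact hfF _ hyV

variable [DecidableEq ι] {B : (ι → ℝ) → Matrix ι ι ℝ}

/-- Functions that agree on `S` have the same derivative along `S`. -/
theorem fderiv_eq_of_eqOn (hU : IsOpen U) (hS : S ⊆ U) {F F' : (ι → ℝ) → ℝ}
    (hF : ContDiffOn ℝ ∞ F U) (hF' : ContDiffOn ℝ ∞ F' U) (h : ∀ x : S, F x = F' x) (x : S)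
    {v : ι → ℝ} (hv : v ∈ tangentSpace S x) : fderiv ℝ F x v = fderiv ℝ F' x v := by
  rw [← differential_eq (restrictSmooth hU hS hF) x F U hU (hS x.2) hF (fun _ _ => rfl) ⟨v, hv⟩,
    differential_eq (restrictSmooth hU hS hF) x F' U hU (hS x.2) hF' (fun y _ => h y) ⟨v, hv⟩]

theorem bivBracket_eq_of_eqOn (hU : IsOpen U) (hS : S ⊆ U)
    (hanti : ∀ c ∈ U, ∀ i j, B c j i = -B c i j)
    (htan : ∀ (x : S) (F : (ι → ℝ) → ℝ), hamField B F x ∈ tangentSpace S x)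
    {F F' G G' : (ι → ℝ) → ℝ} (hF : ContDiffOn ℝ ∞ F U) (hF' : ContDiffOn ℝ ∞ F' U)
    (hG : ContDiffOn ℝ ∞ G U) (hG' : ContDiffOn ℝ ∞ G' U)
    (h : ∀ x : S, F x = F' x) (h' : ∀ x : S, G x = G' x) (x : S) :
    bivBracket B F G x = bivBracket B F' G' x := by
  have ha := hanti x (hS x.2)
  rw [bivBracket_eq_fderiv, fderiv_eq_of_eqOn hU hS hF hF' h x (htan x G), ← bivBracket_eq_fderiv,
    bivBracket_antisymm ha, bivBracket_antisymm ha F' G', bivBracket_eq_fderiv,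
    fderiv_eq_of_eqOn hU hS hG hG' h' x (htan x F'), ← bivBracket_eq_fderiv]

theorem bivBracket_add_left {F F' G : (ι → ℝ) → ℝ} {c : ι → ℝ} (hF : DifferentiableAt ℝ F c)
    (hF' : DifferentiableAt ℝ F' c) :
    bivBracket B (fun x => F x + F' x) G c = bivBracket B F G c + bivBracket B F' G c := by
  simp only [bivBracket_eq_fderiv]
  rw [fderiv_fun_add hF hF']; rfl

theorem bivBracket_smul_left {F G : (ι → ℝ) → ℝ} {c : ι → ℝ} (hF : DifferentiableAt ℝ F c)
    (a : ℝ) : bivBracket B (fun x => a * F x) G c = a * bivBracket B F G c := by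
  simp only [bivBracket_eq_fderiv]
  rw [fderiv_const_mul hF]; simp

theorem bivBracket_add_right {F G G' : (ι → ℝ) → ℝ} {c : ι → ℝ} (hG : DifferentiableAt ℝ G c)
    (hG' : DifferentiableAt ℝ G' c) :
    bivBracket B F (fun x => G x + G' x) c = bivBracket B F G c + bivBracket B F G' c := by
  simp only [bivBracket, partialDeriv_add hG hG', mul_add, Finset.sum_add_distrib]

theorem bivBracket_smul_right {F G : (ι → ℝ) → ℝ} {c : ι → ℝ} (hG : DifferentiableAt ℝ G c)
    (a : ℝ) : bivBracket B F (fun x => a * G x) c = a * bivBracket B F G c := by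
  simp only [bivBracket, partialDeriv_const_mul hG, Finset.mul_sum]
  exact Finset.sum_congr rfl fun i _ => Finset.sum_congr rfl fun j _ => by ring

/-- The bracket `{f, g} = {f ∘ ρ, g ∘ ρ}_B|_S` on `C^∞(S)`. It does not depend on the
retraction `ρ` when `B` is tangent to `S`. -/
def retractBracket (hρ : IsSmoothRetraction U S ρ)
    (hB : ∀ i j, ContDiffOn ℝ ∞ (fun c => B c i j) U) :
    smoothFunctions S →ₗ[ℝ] smoothFunctions S →ₗ[ℝ] smoothFunctions S :=
  have hd : ∀ (f : smoothFunctions S) (x : S), DifferentiableAt ℝ (extendBy ρ (f : S → ℝ)) x :=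
    fun f x => (hρ.contDiffOn_extendBy f).differentiableAt_of_isOpen hρ.isOpen (hρ.subset x.2)
  have hadd : ∀ f g : smoothFunctions S, extendBy ρ ((f + g : smoothFunctions S) : S → ℝ)
      = fun c => extendBy ρ (f : S → ℝ) c + extendBy ρ (g : S → ℝ) c := fun f g => by
    funext c
    by_cases h : ρ c ∈ S
    · simp [extendBy_of_mem _ h]
    · simp [extendBy, Function.extend, h]
  have hsmul : ∀ (a : ℝ) (f : smoothFunctions S), extendBy ρ ((a • f : smoothFunctions S) : S → ℝ)
      = fun c => a * extendBy ρ (f : S → ℝ) c := fun a f => by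
    funext c
    by_cases h : ρ c ∈ S
    · simp [extendBy_of_mem _ h]
    · simp [extendBy, Function.extend, h]
  LinearMap.mk₂ ℝ
    (fun f g => restrictSmooth hρ.isOpen hρ.subset
      (contDiffOn_bivBracket hρ.isOpen hB (hρ.contDiffOn_extendBy f) (hρ.contDiffOn_extendBy g)))
    (fun f f' g => Subtype.ext <| funext fun x => by
      change bivBracket B (extendBy ρ ((f + f' : smoothFunctions S) : S → ℝ)) _ _
        = bivBracket B _ _ _ + bivBracket B _ _ _
      rw [hadd, bivBracket_add_left (hd f x) (hd f' x)])
    (fun a f g => Subtype.ext <| funext fun x => by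
      change bivBracket B (extendBy ρ ((a • f : smoothFunctions S) : S → ℝ)) _ _
        = a * bivBracket B _ _ _
      rw [hsmul, bivBracket_smul_left (hd f x)])
    (fun f g g' => Subtype.ext <| funext fun x => by
      change bivBracket B _ (extendBy ρ ((g + g' : smoothFunctions S) : S → ℝ)) _
        = bivBracket B _ _ _ + bivBracket B _ _ _
      rw [hadd, bivBracket_add_right (hd g x) (hd g' x)])
    (fun a f g => Subtype.ext <| funext fun x => by
      change bivBracket B _ (extendBy ρ ((a • g : smoothFunctions S) : S → ℝ)) _
        = a * bivBracket B _ _ _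
      rw [hsmul, bivBracket_smul_right (hd g x)])

theorem retractBracket_apply (hρ : IsSmoothRetraction U S ρ)
    (hB : ∀ i j, ContDiffOn ℝ ∞ (fun c => B c i j) U) (f g : smoothFunctions S) (x : S) :
    (retractBracket hρ hB f g : S → ℝ) x
      = bivBracket B (extendBy ρ (f : S → ℝ)) (extendBy ρ (g : S → ℝ)) x := rfl

theorem retractBracket_restrictsTo (hρ : IsSmoothRetraction U S ρ)
    (hB : ∀ i j, ContDiffOn ℝ ∞ (fun c => B c i j) U)
    (hanti : ∀ c ∈ U, ∀ i j, B c j i = -B c i j)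
    (htan : ∀ (x : S) (F : (ι → ℝ) → ℝ), hamField B F x ∈ tangentSpace S x) :
    RestrictsTo U B S (retractBracket hρ hB) := by
  refine ⟨hρ.subset, fun F G hF hG f g hf hg x => ?_⟩
  rw [retractBracket_apply]
  exact bivBracket_eq_of_eqOn hρ.isOpen hρ.subset hanti htan (hρ.contDiffOn_extendBy f) hF
    (hρ.contDiffOn_extendBy g) hG (fun x => by rw [hρ.extendBy_apply, hf])
    (fun x => by rw [hρ.extendBy_apply, hg]) x

theorem retractBracket_isPoissonBracket (hρ : IsSmoothRetraction U S ρ) (hB : IsPoissonTensor U B)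
    (htan : ∀ (x : S) (F : (ι → ℝ) → ℝ), hamField B F x ∈ tangentSpace S x) :
    IsPoissonBracket (retractBracket hρ hB.smooth) := by
  have hext := hρ.contDiffOn_extendBy
  refine ⟨fun f => ?_, fun f g h => ?_, fun f g h => ?_⟩
  · ext x
    have := bivBracket_antisymm (hB.antisymm x (hρ.subset x.2)) (extendBy ρ (f : S → ℝ))
      (extendBy ρ (f : S → ℝ))
    change bivBracket B _ _ _ = 0
    linarith
  · ext x
    have hd : ∀ f : smoothFunctions S, DifferentiableAt ℝ (extendBy ρ (f : S → ℝ)) x :=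
      fun f => (hext f).differentiableAt_of_isOpen hρ.isOpen (hρ.subset x.2)
    have hmul : extendBy ρ ((g * h : smoothFunctions S) : S → ℝ)
        = fun c => extendBy ρ (g : S → ℝ) c * extendBy ρ (h : S → ℝ) c := by
      funext c
      by_cases h : ρ c ∈ S
      · simp [extendBy_of_mem _ h]
      · simp [extendBy, Function.extend, h]
    change bivBracket B _ (extendBy ρ ((g * h : smoothFunctions S) : S → ℝ)) _
      = bivBracket B _ _ _ * (h : S → ℝ) x + (g : S → ℝ) x * bivBracket B _ _ _
    rw [hmul, bivBracket_mul_right B (hd g) (hd h), hρ.extendBy_apply, hρ.extendBy_apply]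
  · ext x
    have key : ∀ f g h : smoothFunctions S,
        (retractBracket hρ hB.smooth f (retractBracket hρ hB.smooth g h) : S → ℝ) x
        = bivBracket B (extendBy ρ (f : S → ℝ))
            (bivBracket B (extendBy ρ (g : S → ℝ)) (extendBy ρ (h : S → ℝ))) x := by
      intro f g h
      exact bivBracket_eq_of_eqOn hρ.isOpen hρ.subset hB.antisymm htan (hext f) (hext f)
        (hext _) (contDiffOn_bivBracket hρ.isOpen hB.smooth (hext g) (hext h)) (fun _ => rfl)
        (fun x => by rw [hρ.extendBy_apply, retractBracket_apply]) x
    change (retractBracket hρ hB.smooth f (retractBracket hρ hB.smooth g h) : S → ℝ) x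
      + (retractBracket hρ hB.smooth g (retractBracket hρ hB.smooth h f) : S → ℝ) x
      + (retractBracket hρ hB.smooth h (retractBracket hρ hB.smooth f g) : S → ℝ) x = 0
    rw [key, key, key]
    exact hB.jacobi _ _ _ (hext f) (hext g) (hext h) x (hρ.subset x.2)

theorem retractBracket_isPoissonPencil (hρ : IsSmoothRetraction U S ρ)
    {B₀ B₁ : (ι → ℝ) → Matrix ι ι ℝ} (h : IsPoissonPencilTensor U B₀ B₁)
    (h₁ : ∀ i j, ContDiffOn ℝ ∞ (fun c => B₁ c i j) U)
    (htan₀ : ∀ (x : S) (F : (ι → ℝ) → ℝ), hamField B₀ F x ∈ tangentSpace S x)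
    (htan₁ : ∀ (x : S) (F : (ι → ℝ) → ℝ), hamField B₁ F x ∈ tangentSpace S x) :
    IsPoissonPencil (retractBracket hρ h.base.smooth) (retractBracket hρ h₁) := by
  refine ⟨retractBracket_isPoissonBracket hρ h.base htan₀, fun ν => ?_⟩
  have htan : ∀ (x : S) (F : (ι → ℝ) → ℝ),
      hamField (fun c => B₁ c - ν • B₀ c) F x ∈ tangentSpace S x := fun x F => by
    have : hamField (fun c => B₁ c - ν • B₀ c) F x = hamField B₁ F x - ν • hamField B₀ F x := by
      funext i
      simp only [hamField, Matrix.sub_apply, Matrix.smul_apply, smul_eq_mul, Pi.sub_apply,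
        Pi.smul_apply, Finset.mul_sum, ← Finset.sum_sub_distrib]
      exact Finset.sum_congr rfl fun j _ => by ring
    rw [this]
    exact Submodule.sub_mem _ (htan₁ x F) (Submodule.smul_mem _ _ (htan₀ x F))
  convert retractBracket_isPoissonBracket hρ (h.pencil ν) htan using 1
  refine LinearMap.ext fun f => LinearMap.ext fun g => Subtype.ext (funext fun x => ?_)
  change bivBracket B₁ _ _ _ - ν * bivBracket B₀ _ _ _
    = bivBracket (fun c => B₁ c - ν • B₀ c) _ _ _
  simp only [bivBracket, Matrix.sub_apply, Matrix.smul_apply, smul_eq_mul, Finset.mul_sum,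
    ← Finset.sum_sub_distrib]
  exact Finset.sum_congr rfl fun i _ => Finset.sum_congr rfl fun j _ => by ring

end Retract

/-! ### The two tensors in logarithmic coordinates -/

section Tensors

variable (n : ℕ) [NeZero n]

/-- The vector field `E_m = D_{m-1} + D_m`, where `D_i = c_i ∂_{c_i}`, in the frame `D`. -/
def pairVec (m i : ZMod n) : ℝ := kron n i m + kron n (i + 1) m

/-- The vector field `E_m - E_1`, in the frame `D`. -/
def pairVecSub (m i : ZMod n) : ℝ := pairVec n m i - pairVec n 1 i

/-- The constant bivector field `(E_m - E_1) ∧ (E_{m+1} - E_1)`, in the frame `D`. -/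
def pairWedge (m i j : ZMod n) : ℝ :=
  pairVecSub n m i * pairVecSub n (m + 1) j - pairVecSub n (m + 1) i * pairVecSub n m j

theorem isOpen_phaseSpace : IsOpen (phaseSpace n) := by
  have : phaseSpace n = Set.univ.pi fun _ : ZMod n => Set.Ioi (0 : ℝ) := by
    ext c; simp [phaseSpace]
  rw [this]
  exact isOpen_set_pi Set.finite_univ fun _ _ => isOpen_Ioi

variable {n}

theorem sum_mul_kron (f : ZMod n → ℝ) (a : ZMod n) : ∑ m, f m * kron n a m = f a := by
  simp [kron]

theorem sum_mul_kron_add_one (f : ZMod n → ℝ) (a : ZMod n) :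
    ∑ m, f m * kron n a (m + 1) = f (a - 1) := by
  simp [kron, ← sub_eq_iff_eq_add]

theorem kron_comm (a b : ZMod n) : kron n a b = kron n b a := by
  simp [kron, eq_comm]

theorem tensorP_apply (c : ZMod n → ℝ) (i m : ZMod n) :
    tensorP n c i m = c i * c m * (pairVecSub n m i - pairVecSub n (m + 1) i) := by
  have : kron n (i + 1) (m + 1) = kron n i m := by simp [kron]
  simp only [tensorP, Matrix.of_apply, pairVecSub, pairVec, this, kron_comm (m + 1) i]
  ring

theorem sum_mul_pairVec_mul_pairVec (c : ZMod n → ℝ) (i j : ZMod n) :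
    ∑ m, c m * (pairVec n m i * pairVec n (m + 1) j)
      = c i * (kron n (i + 1) j + kron n i j)
        + c (i + 1) * (kron n (i + 2) j + kron n (i + 1) j) := by
  have h : ∀ m, c m * (pairVec n m i * pairVec n (m + 1) j)
      = (c m * pairVec n (m + 1) j) * kron n i m
        + (c m * pairVec n (m + 1) j) * kron n (i + 1) m := by
    intro m; simp only [pairVec]; ring
  simp only [h, Finset.sum_add_distrib, sum_mul_kron]
  have e1 : ∀ a b : ZMod n, kron n (a + 1) (b + 1) = kron n a b := by simp [kron]
  have e2 : i + 1 + 1 = i + 2 := by ring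
  simp only [pairVec, e1, e2, kron_comm j i, kron_comm j (i + 1), kron_comm (j + 1) (i + 2)]
  have e3 : kron n (i + 2) (j + 1) = kron n (i + 1) j := by rw [← e2, e1]
  rw [kron_comm j (i + 2), e3]

/-- In the frame `D`, the cubic tensor is `∑_m c_m E_m ∧ E_{m+1}`. -/
theorem tensorQ_apply (c : ZMod n → ℝ) (i j : ZMod n) :
    tensorQ n c i j = c i * c j *
      ∑ m, c m * (pairVec n m i * pairVec n (m + 1) j - pairVec n (m + 1) i * pairVec n m j) := by
  have h : ∑ m, c m * (pairVec n m i * pairVec n (m + 1) j - pairVec n (m + 1) i * pairVec n m j)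
      = ∑ m, c m * (pairVec n m i * pairVec n (m + 1) j)
        - ∑ m, c m * (pairVec n m j * pairVec n (m + 1) i) := by
    rw [← Finset.sum_sub_distrib]
    exact Finset.sum_congr rfl fun m _ => by ring
  rw [h, sum_mul_pairVec_mul_pairVec, sum_mul_pairVec_mul_pairVec]
  have k : ∀ (f : ZMod n → ℝ) (a b : ZMod n), f b * kron n a b = f a * kron n a b := by
    intro f a b
    by_cases hab : a = b <;> simp [kron, hab]
  have k0 := k c i j
  have k0' : kron n j i = kron n i j := kron_comm _ _
  have k1 := k c (i + 1) j
  have k1' := k c (j + 1) i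
  have k2 := k c (i + 2) j
  have k3 : kron n (i - 2) j = kron n (j + 2) i := by
    simp only [kron, sub_eq_iff_eq_add, eq_comm (a := i)]
  have k4 := k (fun a => c a * c (a - 1)) (j + 2) i
  have e : j + 2 - 1 = j + 1 := by ring
  have k5 := k (fun a => c (a - 1) * c (a - 2)) (j + 2) i
  have e' : j + 2 - 2 = j := by ring
  simp only [e, e'] at k4 k5
  simp only [tensorQ, Matrix.of_apply, k0', k3]
  linear_combination (c i * c j) * k0 + (c i * c j) * k1 - (c i * c j) * k1'
    - c i * c (i + 1) * k2 - c i * k5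

theorem volterraH_zero (c : ZMod n → ℝ) : volterraH n 0 c = 1 / Real.sqrt (∏ l, c l) := by
  unfold volterraH volterraJ
  rw [Finset.powersetCard_zero, Finset.filter_true_of_mem (by simp)]
  simp

theorem prod_pos_of_mem {c : ZMod n → ℝ} (hc : c ∈ phaseSpace n) : 0 < ∏ l, c l :=
  Finset.prod_pos fun l _ => hc l

theorem contDiffOn_volterraH (i : ℕ) : ContDiffOn ℝ ∞ (volterraH n i) (phaseSpace n) := by
  have hp : ContDiffOn ℝ ∞ (fun c : ZMod n → ℝ => ∏ l, c l) (phaseSpace n) :=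
    (contDiff_prod fun l _ => contDiff_apply ℝ ℝ l).contDiffOn
  have hJ : ContDiffOn ℝ ∞ (volterraJ n i) (phaseSpace n) :=
    (ContDiff.sum fun s _ => contDiff_prod fun l _ => contDiff_apply ℝ ℝ l).contDiffOn
  exact hJ.div (hp.sqrt fun c hc => (prod_pos_of_mem hc).ne')
    fun c hc => (Real.sqrt_pos.2 (prod_pos_of_mem hc)).ne'


/-- The Euler derivative `D_a` of a squarefree monomial. -/
theorem mul_partialDeriv_prod (s : Finset (ZMod n)) (a : ZMod n) (c : ZMod n → ℝ) :
    c a * partialDeriv a (fun c => ∏ l ∈ s, c l) c = if a ∈ s then ∏ l ∈ s, c l else 0 := by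
  have h : HasFDerivAt (fun c : ZMod n → ℝ => ∏ l ∈ s, c l)
      (∑ i ∈ s, (∏ j ∈ s.erase i, c j) • (ContinuousLinearMap.proj i : (ZMod n → ℝ) →L[ℝ] ℝ)) c :=
    HasFDerivAt.finsetProd fun i _ => hasFDerivAt_apply i c
  rw [partialDeriv, h.fderiv]
  simp only [sum_apply, smul_apply,
    ContinuousLinearMap.proj_apply, Pi.single_apply, smul_eq_mul, mul_ite, mul_one, mul_zero,
    Finset.sum_ite_eq']
  split_ifs with ha
  · exact Finset.mul_prod_erase s c ha
  · simp

theorem mul_partialDeriv_volterraH_zero {c : ZMod n → ℝ} (hc : c ∈ phaseSpace n) (a : ZMod n) :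
    c a * partialDeriv a (volterraH n 0) c = -(volterraH n 0 c / 2) := by
  have hH := (contDiffOn_volterraH (n := n) 0).differentiableAt_of_isOpen (isOpen_phaseSpace n) hc
  have hp : DifferentiableAt ℝ (fun c : ZMod n → ℝ => ∏ l, c l) c :=
    (contDiff_prod fun l _ => contDiff_apply ℝ ℝ l).differentiable (n := ∞) (by simp) c
  have hsq : ∀ x ∈ phaseSpace n, volterraH n 0 x * volterraH n 0 x * ∏ l, x l = 1 := by
    intro x hx
    have := prod_pos_of_mem hx
    rw [volterraH_zero, div_mul_div_comm, Real.mul_self_sqrt this.le]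
    field_simp
  have hconst : partialDeriv a (fun x => volterraH n 0 x * volterraH n 0 x * ∏ l, x l) c = 0 := by
    have : (fun x => volterraH n 0 x * volterraH n 0 x * ∏ l, x l) =ᶠ[nhds c] fun _ => (1 : ℝ) := by
      filter_upwards [(isOpen_phaseSpace n).mem_nhds hc] with x hx using hsq x hx
    rw [partialDeriv_congr this]
    simp [partialDeriv]
  rw [partialDeriv_mul (hH.fun_mul hH) hp, partialDeriv_mul hH hH] at hconst
  have hm := mul_partialDeriv_prod Finset.univ a c
  rw [if_pos (Finset.mem_univ a)] at hm
  have h0 : volterraH n 0 c * ∏ l, c l ≠ 0 := fun h => by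
    have := hsq c hc
    rw [mul_assoc, h, mul_zero] at this
    exact zero_ne_one this
  refine mul_left_cancel₀ h0 ?_
  linear_combination (c a / 2) * hconst - (volterraH n 0 c * volterraH n 0 c / 2) * hm

theorem sum_pairVec (m : ZMod n) : ∑ i, pairVec n m i = 2 := by
  have h1 : ∑ i, kron n i m = 1 := by simp [kron]
  have h2 : ∑ i, kron n (i + 1) m = 1 := by
    rw [← h1]
    exact Equiv.sum_comp (Equiv.addRight (1 : ZMod n)) fun i => kron n i m
  simp only [pairVec, Finset.sum_add_distrib, h1, h2]
  norm_num

theorem volterraH_zero_pos {c : ZMod n → ℝ} (hc : c ∈ phaseSpace n) : 0 < volterraH n 0 c := by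
  rw [volterraH_zero]
  have := Real.sqrt_pos.2 (prod_pos_of_mem hc)
  positivity

theorem fieldX_apply {c : ZMod n → ℝ} (hc : c ∈ phaseSpace n) (i : ZMod n) :
    fieldX n c i
      = -(volterraH n 0 c) * (c i * ∑ m, c m * (pairVec n m i - pairVec n (m + 1) i)) := by
  have h : ∀ j, tensorQ n c i j * partialDeriv j (volterraH n 0) c
      = ∑ m, -(volterraH n 0 c / 2) * c i * c m * (pairVec n m i * pairVec n (m + 1) j
        - pairVec n (m + 1) i * pairVec n m j) := by
    intro j
    rw [tensorQ_apply, mul_assoc (c i), mul_assoc (c i), mul_right_comm (c j),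
      mul_partialDeriv_volterraH_zero hc, Finset.mul_sum, Finset.mul_sum]
    exact Finset.sum_congr rfl fun m _ => by ring
  rw [fieldX, hamField]
  simp only [h]
  rw [Finset.sum_comm, Finset.mul_sum, Finset.mul_sum]
  refine Finset.sum_congr rfl fun m _ => ?_
  rw [← Finset.mul_sum, Finset.sum_sub_distrib, ← Finset.mul_sum, ← Finset.mul_sum, sum_pairVec,
    sum_pairVec]
  ring

theorem fieldZ_apply (c : ZMod n → ℝ) (i : ZMod n) :
    fieldZ n c i = -(1 / volterraH n 0 c) * (c i * pairVec n 1 i) := by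
  have h : fieldZ₀ n c i = c i * pairVec n 1 i := by
    have e : kron n (i + 1) 1 = kron n i 0 := by simp [kron]
    simp only [fieldZ₀, pairVec, e]
    simp only [kron, Pi.add_apply, Pi.smul_apply, Pi.single_apply, smul_eq_mul,
      mul_ite, mul_one, mul_zero, mul_add]
    congr 1
    · by_cases h : i = 1 <;> simp [h]
    · by_cases h : i = 0 <;> simp [h]
  simp [fieldZ, h]

/-- In the frame `D`, the deformed tensor is `∑_m c_m (E_m - E_1) ∧ (E_{m+1} - E_1)`. -/
theorem tensorQdef_apply {c : ZMod n → ℝ} (hc : c ∈ phaseSpace n) (i j : ZMod n) :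
    tensorQdef n c i j = c i * c j * ∑ m, c m * pairWedge n m i j := by
  have h0 := (volterraH_zero_pos hc).ne'
  have hw : wedge (fieldX n) (fieldZ n) c i j = c i * c j *
      ∑ m, c m * ((pairVec n m i - pairVec n (m + 1) i) * pairVec n 1 j
        - pairVec n 1 i * (pairVec n m j - pairVec n (m + 1) j)) := by
    have : ∑ m, c m * ((pairVec n m i - pairVec n (m + 1) i) * pairVec n 1 j
        - pairVec n 1 i * (pairVec n m j - pairVec n (m + 1) j))
        = (∑ m, c m * (pairVec n m i - pairVec n (m + 1) i)) * pairVec n 1 j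
          - pairVec n 1 i * ∑ m, c m * (pairVec n m j - pairVec n (m + 1) j) := by
      rw [Finset.sum_mul, Finset.mul_sum, ← Finset.sum_sub_distrib]
      exact Finset.sum_congr rfl fun m _ => by ring
    rw [this]
    simp only [wedge, Matrix.of_apply, fieldX_apply hc, fieldZ_apply]
    field_simp
  rw [tensorQdef, Matrix.sub_apply, hw, tensorQ_apply, ← mul_sub, ← Finset.sum_sub_distrib]
  congr 1
  refine Finset.sum_congr rfl fun m _ => ?_
  simp only [pairWedge, pairVecSub]
  ring

end Tensors

/-! ### The Poisson pencil -/

section LogLinear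

variable {ι : Type*} [Fintype ι] [DecidableEq ι]

/-- A tensor field that in the frame `D_i = c_i ∂_{c_i}` has the components
`b₀ + ∑_m c_m β_m` with constant `b₀` and `β_m` is Poisson as soon as the quadratic identity
`hjac` holds. -/
theorem isPoissonTensor_of_logLinear {U : Set (ι → ℝ)} (hU : IsOpen U)
    {B : (ι → ℝ) → Matrix ι ι ℝ} (b₀ : ι → ι → ℝ) (β : ι → ι → ι → ℝ)
    (hB : ∀ c ∈ U, ∀ i j, B c i j = c i * c j * (b₀ i j + ∑ m, c m * β m i j))
    (h₀ : ∀ i j, b₀ j i = -b₀ i j) (hβ : ∀ m i j, β m j i = -β m i j)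
    (hjac : ∀ c ∈ U, ∀ i j k, ∑ m, c m * ((b₀ i m + ∑ l, c l * β l i m) * β m j k
      + (b₀ j m + ∑ l, c l * β l j m) * β m k i
      + (b₀ k m + ∑ l, c l * β l k m) * β m i j) = 0) :
    IsPoissonTensor U B := by
  set b : (ι → ℝ) → ι → ι → ℝ := fun c i j => b₀ i j + ∑ m, c m * β m i j with hb
  have hbanti : ∀ c i j, b c j i = -b c i j := by
    intro c i j
    simp only [hb, h₀ i j, hβ _ i j, mul_neg, Finset.sum_neg_distrib]
    ring
  have hbsm : ∀ i j, ContDiff ℝ ∞ fun c => b c i j := by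
    intro i j
    exact contDiff_const.add (ContDiff.sum fun m _ => (contDiff_apply ℝ ℝ m).mul contDiff_const)
  have hcoord : ∀ (i l : ι) (c : ι → ℝ),
      partialDeriv l (fun c => c i) c = if i = l then 1 else 0 := by
    intro i l c
    rw [partialDeriv, (hasFDerivAt_apply (𝕜 := ℝ) i c).fderiv]
    simp [Pi.single_apply]
  have hbd : ∀ (i j l : ι) (c : ι → ℝ), partialDeriv l (fun c => b c i j) c = β l i j := by
    intro i j l c
    have : HasFDerivAt (fun c => b c i j)
        (∑ m, (β m i j) • (ContinuousLinearMap.proj m : (ι → ℝ) →L[ℝ] ℝ)) c :=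
      (HasFDerivAt.fun_sum fun m _ => (hasFDerivAt_apply m c).mul_const (β m i j)).const_add _
    rw [partialDeriv, this.fderiv]
    simp [Pi.single_apply]
  have hpd : ∀ c ∈ U, ∀ l i j, c l * partialDeriv l (fun c => B c i j) c
      = c i * c j * (((if i = l then 1 else 0) + (if j = l then 1 else 0)) * b c i j
        + c l * β l i j) := by
    intro c hc l i j
    have hi : ∀ i : ι, DifferentiableAt ℝ (fun c : ι → ℝ => c i) c := fun i =>
      differentiableAt_apply i c
    have hE : (fun c => B c i j) =ᶠ[nhds c] fun c => c i * c j * b c i j := by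
      filter_upwards [hU.mem_nhds hc] with x hx using hB x hx i j
    rw [partialDeriv_congr hE, partialDeriv_mul ((hi i).fun_mul (hi j))
      ((hbsm i j).differentiable (by simp) c), partialDeriv_mul (hi i) (hi j), hcoord, hcoord, hbd]
    by_cases h1 : i = l <;> by_cases h2 : j = l <;> simp [h1, h2] <;> ring
  refine isPoissonTensor_of_components hU ?_ ?_ ?_
  · intro i j
    refine ContDiffOn.congr (f := fun c => c i * c j * b c i j) ?_ fun c hc => hB c hc i j
    exact (((contDiff_apply ℝ ℝ i).mul (contDiff_apply ℝ ℝ j)).mul (hbsm i j)).contDiffOn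
  · intro c hc i j
    rw [hB c hc, hB c hc]
    have := hbanti c i j
    simp only [hb] at this
    rw [this]; ring
  · intro c hc i j k
    have key : ∀ i j k l, B c i l * partialDeriv l (fun x => B x j k) c
        = c i * c j * c k * ((if j = l then b c i l * b c j k else 0)
          + (if k = l then b c i l * b c j k else 0) + c l * (b c i l * β l j k)) := by
      intro i j k l
      rw [hB c hc, mul_assoc (c i), mul_assoc (c i), mul_right_comm, hpd c hc]
      change c i * (c j * c k * _ * b c i l) = _
      by_cases h1 : j = l <;> by_cases h2 : k = l <;> simp [h1, h2] <;> ring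
    simp only [key, Finset.sum_add_distrib, ← Finset.mul_sum, Finset.sum_ite_eq, Finset.mem_univ,
      if_true]
    have hj := hjac c hc i j k
    simp only [mul_add, Finset.sum_add_distrib] at hj
    have hj' : ∑ l, c l * (b c i l * β l j k) + ∑ l, c l * (b c j l * β l k i)
        + ∑ l, c l * (b c k l * β l i j) = 0 := hj
    have a1 := hbanti c i j
    have a2 := hbanti c j k
    have a3 := hbanti c i k
    rw [a1, a2, a3]
    linear_combination (c i * c j * c k) * hj'

end LogLinear

section Pencil

variable {n : ℕ} [NeZero n]

theorem pairVecSub_one (i : ZMod n) : pairVecSub n 1 i = 0 := sub_self _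

theorem pairWedge_zero (i j : ZMod n) : pairWedge n 0 i j = 0 := by
  simp [pairWedge, pairVecSub_one]

theorem pairWedge_one (i j : ZMod n) : pairWedge n 1 i j = 0 := by
  simp [pairWedge, pairVecSub_one]

/-- Pairing the differential `d log c_m` with `E_l - E_1` before multiplying with the bivector
`(E_m - E_1) ∧ (E_{m+1} - E_1)`: the part of `E_1` drops out, since it only sees the sites `0` and
`1`, where the bivector vanishes. -/
theorem pairVecSub_mul_pairWedge (l m j k : ZMod n) :
    pairVecSub n l m * pairWedge n m j k = pairVec n l m * pairWedge n m j k := by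
  have : pairVec n 1 m * pairWedge n m j k = 0 := by
    by_cases h1 : m = 1
    · rw [h1, pairWedge_one, mul_zero]
    by_cases h0 : m = 0
    · rw [h0, pairWedge_zero, mul_zero]
    simp [pairVec, kron, h1, h0]
  rw [pairVecSub, sub_mul, this, sub_zero]

theorem sum_pairVec_mul (l : ZMod n) (f : ZMod n → ℝ) :
    ∑ m, pairVec n l m * f m = f l + f (l - 1) := by
  simp only [pairVec, add_mul, Finset.sum_add_distrib]
  congr 1
  · simp [kron]
  · simp [kron, ← eq_sub_iff_add_eq]

theorem pairWedge_antisymm (m i j : ZMod n) : pairWedge n m j i = -pairWedge n m i j := by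
  simp only [pairWedge]; ring

theorem pairVecSub_sub_antisymm (i j : ZMod n) :
    pairVecSub n i j - pairVecSub n (i + 1) j
      = -(pairVecSub n j i - pairVecSub n (j + 1) i) := by
  have e : ∀ a b : ZMod n, kron n (a + 1) (b + 1) = kron n a b := by simp [kron]
  simp only [pairVecSub, pairVec, e, kron_comm j, kron_comm (j + 1)]
  ring

theorem tensorQdef_sub_apply (ν : ℝ) {c : ZMod n → ℝ} (hc : c ∈ phaseSpace n) (i j : ZMod n) :
    (tensorQdef n c - ν • tensorP n c) i j = c i * c j *
      (-ν * (pairVecSub n j i - pairVecSub n (j + 1) i) + ∑ m, c m * pairWedge n m i j) := by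
  rw [Matrix.sub_apply, Matrix.smul_apply, tensorQdef_apply hc, tensorP_apply, smul_eq_mul]
  ring

theorem sum_mul_sum_pairWedge (c : ZMod n → ℝ) (i j k : ZMod n) :
    ∑ m, c m * ((∑ l, c l * pairWedge n l i m) * pairWedge n m j k)
      = ∑ l, (c l * c l * ((pairVecSub n l i - pairVecSub n (l + 1) i) * pairWedge n l j k)
        + c l * c (l + 1) * (pairVecSub n l i * pairWedge n (l + 1) j k
          - pairVecSub n (l + 1 + 1) i * pairWedge n l j k)) := by
  have h1 : ∑ m, c m * ((∑ l, c l * pairWedge n l i m) * pairWedge n m j k)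
      = ∑ l, (c l * pairVecSub n l i * ∑ m, pairVec n (l + 1) m * (c m * pairWedge n m j k)
        - c l * pairVecSub n (l + 1) i * ∑ m, pairVec n l m * (c m * pairWedge n m j k)) := by
    simp only [Finset.sum_mul, Finset.mul_sum, ← Finset.sum_sub_distrib]
    rw [Finset.sum_comm]
    refine Finset.sum_congr rfl fun l _ => Finset.sum_congr rfl fun m _ => ?_
    have e1 := pairVecSub_mul_pairWedge l m j k
    have e2 := pairVecSub_mul_pairWedge (l + 1) m j k
    have e3 : pairWedge n l i m = pairVecSub n l i * pairVecSub n (l + 1) m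
      - pairVecSub n (l + 1) i * pairVecSub n l m := rfl
    rw [e3]
    linear_combination c m * c l * pairVecSub n l i * e2 - c m * c l * pairVecSub n (l + 1) i * e1
  have shift : ∑ l, c l * pairVecSub n (l + 1) i * (c (l - 1) * pairWedge n (l - 1) j k)
      = ∑ l, c (l + 1) * pairVecSub n (l + 1 + 1) i * (c l * pairWedge n l j k) := by
    rw [← Equiv.sum_comp (Equiv.addRight (1 : ZMod n))]
    simp
  rw [h1]
  simp only [sum_pairVec_mul, mul_add, add_sub_cancel_right, Finset.sum_sub_distrib,
    Finset.sum_add_distrib, shift]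
  simp only [← Finset.sum_sub_distrib, ← Finset.sum_add_distrib]
  exact Finset.sum_congr rfl fun l _ => by ring

theorem isPoissonTensor_pencil (ν : ℝ) :
    IsPoissonTensor (phaseSpace n) (fun c => tensorQdef n c - ν • tensorP n c) := by
  refine isPoissonTensor_of_logLinear (isOpen_phaseSpace n)
    (fun i j => -ν * (pairVecSub n j i - pairVecSub n (j + 1) i)) (pairWedge n)
    (fun c hc => tensorQdef_sub_apply ν hc) ?_ pairWedge_antisymm ?_
  · intro i j
    rw [pairVecSub_sub_antisymm]; ring
  · intro c _ i j k
    have hP : ∀ i j k, ∑ m, c m * ((-ν * (pairVecSub n m i - pairVecSub n (m + 1) i)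
          + ∑ l, c l * pairWedge n l i m) * pairWedge n m j k)
        = ∑ m, c m * (-ν * ((pairVecSub n m i - pairVecSub n (m + 1) i) * pairWedge n m j k))
          + ∑ m, c m * ((∑ l, c l * pairWedge n l i m) * pairWedge n m j k) := by
      intro i j k
      rw [← Finset.sum_add_distrib]
      exact Finset.sum_congr rfl fun m _ => by ring
    simp only [mul_add (c _), Finset.sum_add_distrib (f := fun _ => _ + _),
      Finset.sum_add_distrib, hP, sum_mul_sum_pairWedge]
    simp only [← Finset.sum_add_distrib]
    refine Finset.sum_eq_zero fun m _ => ?_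
    simp only [pairWedge]
    ring

theorem isPoissonTensor_tensorP : IsPoissonTensor (phaseSpace n) (tensorP n) := by
  refine isPoissonTensor_of_logLinear (isOpen_phaseSpace n)
    (fun i j => pairVecSub n j i - pairVecSub n (j + 1) i) (fun _ _ _ => 0)
    (fun c _ i j => by rw [tensorP_apply]; simp) pairVecSub_sub_antisymm (by simp) (by simp)

theorem isPoissonPencilTensor_volterra :
    IsPoissonPencilTensor (phaseSpace n) (tensorP n) (tensorQdef n) :=
  ⟨isPoissonTensor_tensorP, isPoissonTensor_pencil⟩

end Pencil

/-! ### The Lenard recursion and involutivity -/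

section Recursion

variable {n : ℕ} [NeZero n]

variable (n) in
/-- The totally disconnected sets of `i` sites. -/
def indepSets (i : ℕ) : Finset (Finset (ZMod n)) :=
  {s ∈ Finset.univ.powersetCard i | ∀ l ∈ s, l + 1 ∉ s}

theorem mem_indepSets {i : ℕ} {s : Finset (ZMod n)} :
    s ∈ indepSets n i ↔ s.card = i ∧ ∀ l ∈ s, l + 1 ∉ s := by
  simp [indepSets, Finset.mem_powersetCard]

theorem volterraJ_eq (i : ℕ) (c : ZMod n → ℝ) :
    volterraJ n i c = ∑ s ∈ indepSets n i, ∏ l ∈ s, c l := rfl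

/-- The Euler derivative `D_a J_i`, i.e. the part of `J_i` of the sets that contain the site `a`. -/
def eulerJ (i : ℕ) (a : ZMod n) (c : ZMod n → ℝ) : ℝ :=
  ∑ s ∈ indepSets n i with a ∈ s, ∏ l ∈ s, c l

theorem mul_partialDeriv_volterraJ (i : ℕ) (a : ZMod n) (c : ZMod n → ℝ) :
    c a * partialDeriv a (volterraJ n i) c = eulerJ i a c := by
  have hd : ∀ s ∈ indepSets n i, DifferentiableAt ℝ (fun c : ZMod n → ℝ => ∏ l ∈ s, c l) c :=
    fun s _ => (contDiff_prod fun l _ => contDiff_apply ℝ ℝ l).differentiable (n := ∞) (by simp) c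
  have : volterraJ n i = fun c => ∑ s ∈ indepSets n i, ∏ l ∈ s, c l := rfl
  rw [this, partialDeriv_sum _ hd, Finset.mul_sum, eulerJ, Finset.sum_filter]
  exact Finset.sum_congr rfl fun s _ => mul_partialDeriv_prod s a c

theorem mul_partialDeriv_volterraH {c : ZMod n → ℝ} (hc : c ∈ phaseSpace n) (i : ℕ) (a : ZMod n) :
    c a * partialDeriv a (volterraH n i) c
      = volterraH n 0 c * (eulerJ i a c - volterraJ n i c / 2) := by
  have hJ : DifferentiableAt ℝ (volterraJ n i) c :=
    (ContDiff.sum fun s _ => contDiff_prod fun l _ => contDiff_apply ℝ ℝ l).differentiable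
      (n := ∞) (by simp) c
  have hH := (contDiffOn_volterraH (n := n) 0).differentiableAt_of_isOpen (isOpen_phaseSpace n) hc
  have : volterraH n i = fun c => volterraJ n i c * volterraH n 0 c := by
    funext c
    rw [volterraH_zero, volterraH, mul_one_div]
  rw [this, partialDeriv_mul hJ hH, mul_add, ← mul_assoc, mul_partialDeriv_volterraJ,
    mul_left_comm, mul_partialDeriv_volterraH_zero hc]
  ring

/-- Removing the site `a` from a disconnected set. A lattice with a single site has to be excluded:
there the site is its own neighbour. -/
theorem eulerJ_succ (hn : n ≠ 1) (i : ℕ) (a : ZMod n) (c : ZMod n → ℝ) :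
    eulerJ (i + 1) a c
      = c a * ∑ s ∈ indepSets n i with a - 1 ∉ s ∧ a ∉ s ∧ a + 1 ∉ s, ∏ l ∈ s, c l := by
  have h1 : (1 : ZMod n) ≠ 0 := by
    have : Fact (1 < n) := ⟨by have := NeZero.ne n; omega⟩
    exact one_ne_zero
  rw [eulerJ, Finset.mul_sum]
  refine Finset.sum_nbij' (fun s => s.erase a) (fun s => insert a s) ?_ ?_ ?_ ?_ ?_
  · intro s hs
    obtain ⟨hs, ha⟩ := Finset.mem_filter.1 hs
    obtain ⟨hcard, hind⟩ := mem_indepSets.1 hs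
    refine Finset.mem_filter.2 ⟨mem_indepSets.2 ⟨by simp [Finset.card_erase_of_mem ha, hcard],
      fun l hl => ?_⟩, ?_, by simp, ?_⟩
    · exact fun h => hind l (Finset.mem_of_mem_erase hl) (Finset.mem_of_mem_erase h)
    · intro h
      exact hind _ (Finset.mem_of_mem_erase h) (by simpa using ha)
    · exact fun h => hind a ha (Finset.mem_of_mem_erase h)
  · intro s hs
    obtain ⟨hs, ha1, ha, ha2⟩ := Finset.mem_filter.1 hs
    obtain ⟨hcard, hind⟩ := mem_indepSets.1 hs
    refine Finset.mem_filter.2 ⟨mem_indepSets.2 ⟨by simp [Finset.card_insert_of_notMem ha, hcard],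
      fun l hl h => ?_⟩, by simp⟩
    rcases Finset.mem_insert.1 hl with rfl | hl
    · rcases Finset.mem_insert.1 h with h | h
      · exact h1 (by simpa using h)
      · exact ha2 h
    · rcases Finset.mem_insert.1 h with h | h
      · exact ha1 (by rw [← h]; simpa using hl)
      · exact hind l hl h
  · intro s hs
    exact Finset.insert_erase (Finset.mem_filter.1 hs).2
  · intro s hs
    exact Finset.erase_insert (Finset.mem_filter.1 hs).2.2.1
  · intro s hs
    exact (Finset.mul_prod_erase s c (Finset.mem_filter.1 hs).2).symm

/-- Moving a particle from the site `a` to the site `a - 1`. -/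
theorem mul_sum_indepSets_move (i : ℕ) (a b : ZMod n) (hab : a = b + 1) (c : ZMod n → ℝ) :
    c b * ∑ s ∈ indepSets n i with a ∈ s ∧ b - 1 ∉ s, ∏ l ∈ s, c l
      = c a * ∑ s ∈ indepSets n i with b ∈ s ∧ a + 1 ∉ s, ∏ l ∈ s, c l := by
  subst hab
  rw [Finset.mul_sum, Finset.mul_sum]
  refine Finset.sum_nbij' (fun s => insert b (s.erase (b + 1)))
    (fun s => insert (b + 1) (s.erase b)) ?_ ?_ ?_ ?_ ?_
  · intro s hs
    obtain ⟨hs, ha, hb⟩ := Finset.mem_filter.1 hs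
    obtain ⟨hcard, hind⟩ := mem_indepSets.1 hs
    have hbs : b ∉ s := fun h => hind b h ha
    have hne : b ≠ b + 1 := fun h => hbs (h ▸ ha)
    refine Finset.mem_filter.2 ⟨mem_indepSets.2 ⟨?_, fun l hl h => ?_⟩, by simp, ?_⟩
    · rw [Finset.card_insert_of_notMem (fun h => hbs (Finset.mem_of_mem_erase h)),
        Finset.card_erase_add_one ha, hcard]
    · rcases Finset.mem_insert.1 hl with rfl | hl
      · rcases Finset.mem_insert.1 h with h | h
        · exact hne h.symm
        · exact (Finset.mem_erase.1 h).1 rfl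
      · rcases Finset.mem_insert.1 h with h | h
        · exact hb (by rw [← h]; simpa using Finset.mem_of_mem_erase hl)
        · exact hind l (Finset.mem_of_mem_erase hl) (Finset.mem_of_mem_erase h)
    · intro h
      rcases Finset.mem_insert.1 h with h | h
      · have e : b - 1 = b + 1 := by rw [sub_eq_iff_eq_add]; exact h.symm
        exact hb (e ▸ ha)
      · exact hind _ ha (Finset.mem_of_mem_erase h)
  · intro s hs
    obtain ⟨hs, hb, ha⟩ := Finset.mem_filter.1 hs
    obtain ⟨hcard, hind⟩ := mem_indepSets.1 hs
    have has : b + 1 ∉ s := hind b hb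
    have hne : b ≠ b + 1 := fun h => has (h ▸ hb)
    refine Finset.mem_filter.2 ⟨mem_indepSets.2 ⟨?_, fun l hl h => ?_⟩, by simp, ?_⟩
    · rw [Finset.card_insert_of_notMem (fun h => has (Finset.mem_of_mem_erase h)),
        Finset.card_erase_add_one hb, hcard]
    · rcases Finset.mem_insert.1 hl with rfl | hl
      · rcases Finset.mem_insert.1 h with h | h
        · exact hne (by simpa using h.symm)
        · exact ha (Finset.mem_of_mem_erase h)
      · rcases Finset.mem_insert.1 h with h | h
        · exact (Finset.mem_erase.1 hl).1 (by simpa using h)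
        · exact hind l (Finset.mem_of_mem_erase hl) (Finset.mem_of_mem_erase h)
    · intro h
      rcases Finset.mem_insert.1 h with h | h
      · exact ha (by rw [← h]; simpa using hb)
      · exact hind _ (Finset.mem_of_mem_erase h) (by simpa using hb)
  · intro s hs
    obtain ⟨hs, ha, hb⟩ := Finset.mem_filter.1 hs
    have hbs : b ∉ s := fun h => (mem_indepSets.1 hs).2 b h ha
    rw [Finset.erase_insert (fun h => hbs (Finset.mem_of_mem_erase h)), Finset.insert_erase ha]
  · intro s hs
    obtain ⟨hs, hb, ha⟩ := Finset.mem_filter.1 hs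
    have has : b + 1 ∉ s := (mem_indepSets.1 hs).2 b hb
    rw [Finset.erase_insert (fun h => has (Finset.mem_of_mem_erase h)), Finset.insert_erase hb]
  · intro s hs
    obtain ⟨hs, ha, hb⟩ := Finset.mem_filter.1 hs
    have hbs : b ∉ s := fun h => (mem_indepSets.1 hs).2 b h ha
    rw [Finset.prod_insert (fun h => hbs (Finset.mem_of_mem_erase h)),
      ← Finset.mul_prod_erase s c ha]
    ring

theorem hamField_tensorP (F : (ZMod n → ℝ) → ℝ) (c : ZMod n → ℝ) (i : ZMod n) :
    hamField (tensorP n) F c i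
      = c i * (c (i + 1) * partialDeriv (i + 1) F c - c (i - 1) * partialDeriv (i - 1) F c) := by
  have h : ∀ j, tensorP n c i j * partialDeriv j F c
      = c i * ((c j * partialDeriv j F c) * kron n (i + 1) j
        - (c j * partialDeriv j F c) * kron n i (j + 1)) := by
    intro j
    simp only [tensorP, Matrix.of_apply, kron_comm (j + 1)]
    ring
  rw [hamField]
  simp only [h]
  rw [← Finset.mul_sum, Finset.sum_sub_distrib, sum_mul_kron, sum_mul_kron_add_one]

theorem hamField_tensorQ (F : (ZMod n → ℝ) → ℝ) (c : ZMod n → ℝ) (i : ZMod n)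
    (G : ZMod n → ℝ)
    (hG : ∀ m, G m = c m * partialDeriv m F c + c (m - 1) * partialDeriv (m - 1) F c) :
    hamField (tensorQ n) F c i
      = c i * (c i * (G (i + 1) - G i) + c (i + 1) * G (i + 2) - c (i - 1) * G (i - 1)) := by
  have hsum : ∀ m, ∑ j, pairVec n m j * (c j * partialDeriv j F c) = G m := by
    intro m
    rw [sum_pairVec_mul m fun j => c j * partialDeriv j F c, hG]
  have h : ∀ j, tensorQ n c i j * partialDeriv j F c
      = ∑ m, (c i * c m * pairVec n m i * (pairVec n (m + 1) j * (c j * partialDeriv j F c))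
        - c i * c m * pairVec n (m + 1) i * (pairVec n m j * (c j * partialDeriv j F c))) := by
    intro j
    rw [tensorQ_apply, Finset.mul_sum, Finset.sum_mul]
    exact Finset.sum_congr rfl fun m _ => by ring
  rw [hamField]
  simp only [h]
  rw [Finset.sum_comm]
  simp only [Finset.sum_sub_distrib, ← Finset.mul_sum, hsum]
  have e1 : ∑ m, c i * c m * pairVec n m i * G (m + 1)
      = c i * (c i * G (i + 1) + c (i + 1) * G (i + 2)) := by
    have : ∀ m, c i * c m * pairVec n m i * G (m + 1)
        = c i * ((c m * G (m + 1)) * kron n i m + (c m * G (m + 1)) * kron n (i + 1) m) := by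
      intro m; simp only [pairVec]; ring
    simp only [this, ← Finset.mul_sum, Finset.sum_add_distrib, sum_mul_kron]
    have : i + 1 + 1 = i + 2 := by ring
    rw [this]
  have e2 : ∑ m, c i * c m * pairVec n (m + 1) i * G m
      = c i * (c (i - 1) * G (i - 1) + c i * G i) := by
    have e : ∀ a b : ZMod n, kron n (a + 1) (b + 1) = kron n a b := by simp [kron]
    have : ∀ m, c i * c m * pairVec n (m + 1) i * G m
        = c i * ((c m * G m) * kron n i (m + 1) + (c m * G m) * kron n i m) := by
      intro m; simp only [pairVec, e]; ring
    simp only [this, ← Finset.mul_sum, Finset.sum_add_distrib, sum_mul_kron, sum_mul_kron_add_one]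
  rw [e1, e2]
  ring

/-- Inclusion and exclusion for the sets that avoid `a - 1`, `a` and `a + 1`, in two forms that are
exchanged by the reflection of the lattice. -/
theorem eulerJ_succ_eq (hn : n ≠ 1) (i : ℕ) (a : ZMod n) (c : ZMod n → ℝ) :
    eulerJ (i + 1) a c = c a * (volterraJ n i c - eulerJ i a c - eulerJ i (a - 1) c
      - ∑ s ∈ indepSets n i with a + 1 ∈ s ∧ a - 1 ∉ s, ∏ l ∈ s, c l) ∧
    eulerJ (i + 1) a c = c a * (volterraJ n i c - eulerJ i a c - eulerJ i (a + 1) c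
      - ∑ s ∈ indepSets n i with a - 1 ∈ s ∧ a + 1 ∉ s, ∏ l ∈ s, c l) := by
  rw [eulerJ_succ hn, volterraJ_eq, eulerJ, eulerJ, eulerJ]
  simp only [Finset.sum_filter, ← Finset.sum_sub_distrib]
  constructor <;> congr 1 <;> refine Finset.sum_congr rfl fun s hs => ?_
  all_goals
    have hind := (mem_indepSets.1 hs).2
    have h1 : a ∈ s → a + 1 ∉ s := hind a
    have h2 : a - 1 ∈ s → a ∉ s := fun h => by simpa using hind _ h
    by_cases ha : a ∈ s <;> by_cases hb : a - 1 ∈ s <;> by_cases hd : a + 1 ∈ s <;> simp_all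

/-- The Lenard recursion `Q d𝓗_i = -P d𝓗_{i+1}`. -/
theorem hamField_tensorQ_volterraH {c : ZMod n → ℝ} (hc : c ∈ phaseSpace n) (i : ℕ) :
    hamField (tensorQ n) (volterraH n i) c = -hamField (tensorP n) (volterraH n (i + 1)) c := by
  funext j
  rw [Pi.neg_apply, hamField_tensorP, hamField_tensorQ _ c j
    (fun m => volterraH n 0 c * (eulerJ i m c + eulerJ i (m - 1) c - volterraJ n i c))
    (fun m => by rw [mul_partialDeriv_volterraH hc, mul_partialDeriv_volterraH hc]; ring)]
  simp only [mul_partialDeriv_volterraH hc]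
  -- On a lattice with a single site both tensors vanish.
  by_cases hn : n = 1
  · subst hn
    simp [Subsingleton.elim (_ : ZMod 1) 0]
  -- The sets avoiding three consecutive sites cancel; the differences that remain are matched by
  -- moving the particle at `j` to `j + 1` or `j - 1`.
  have s1 : j + 2 - 1 = j + 1 := by ring
  have s2 : j + 1 - 1 = j := by ring
  have s3 : j - 1 + 1 = j := by ring
  have s4 : j + 1 + 1 = j + 2 := by ring
  have r1 := (eulerJ_succ_eq hn i (j + 1) c).2
  have r2 := (eulerJ_succ_eq hn i (j - 1) c).1
  have m1 := mul_sum_indepSets_move i (j + 1) j rfl c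
  have m2 := mul_sum_indepSets_move i j (j - 1) s3.symm c
  have m3 : (∑ s ∈ indepSets n i with j + 1 ∈ s ∧ j - 1 ∉ s, ∏ l ∈ s, c l)
      - (∑ s ∈ indepSets n i with j - 1 ∈ s ∧ j + 1 ∉ s, ∏ l ∈ s, c l)
      = eulerJ i (j + 1) c - eulerJ i (j - 1) c := by
    simp only [eulerJ, Finset.sum_filter, ← Finset.sum_sub_distrib]
    refine Finset.sum_congr rfl fun s _ => ?_
    by_cases hb : j - 1 ∈ s <;> by_cases hd : j + 1 ∈ s <;> simp [hb, hd]
  rw [s1, s2]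
  rw [s2, s4] at r1
  rw [s4] at m1
  rw [s3] at r2
  linear_combination (c j * volterraH n 0 c) * (r1 - r2 + m1 + m2 - c j * m3)

theorem hamField_tensorP_volterraH_zero {c : ZMod n → ℝ} (hc : c ∈ phaseSpace n) :
    hamField (tensorP n) (volterraH n 0) c = 0 := by
  funext i
  rw [hamField_tensorP, mul_partialDeriv_volterraH_zero hc, mul_partialDeriv_volterraH_zero hc]
  simp

theorem tensorQ_antisymm (c : ZMod n → ℝ) (i j : ZMod n) : tensorQ n c j i = -tensorQ n c i j := by
  rw [tensorQ_apply, tensorQ_apply, ← mul_neg, ← Finset.sum_neg_distrib, mul_comm (c j)]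
  congr 1
  exact Finset.sum_congr rfl fun m _ => by ring

theorem bivBracket_tensorQ_volterraH {c : ZMod n → ℝ} (hc : c ∈ phaseSpace n) (i j : ℕ) :
    bivBracket (tensorQ n) (volterraH n i) (volterraH n j) c
      = -bivBracket (tensorP n) (volterraH n i) (volterraH n (j + 1)) c := by
  rw [bivBracket_eq_fderiv, hamField_tensorQ_volterraH hc, map_neg, ← bivBracket_eq_fderiv]

/-- The recursion moves the indices towards `P d𝓗_0 = 0`. -/
theorem bivBracket_tensorP_volterraH {c : ZMod n → ℝ} (hc : c ∈ phaseSpace n) (i j : ℕ) :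
    bivBracket (tensorP n) (volterraH n i) (volterraH n j) c = 0 := by
  induction j generalizing i with
  | zero => rw [bivBracket_eq_fderiv, hamField_tensorP_volterraH_zero hc, map_zero]
  | succ j ih =>
    have h1 := bivBracket_tensorQ_volterraH hc i j
    have h2 := bivBracket_tensorQ_volterraH hc j i
    have h3 := bivBracket_antisymm (tensorQ_antisymm c) (volterraH n i) (volterraH n j)
    have h4 := bivBracket_antisymm (isPoissonTensor_tensorP.antisymm c hc) (volterraH n j)
      (volterraH n (i + 1))
    rw [ih (i + 1)] at h4
    linarith

theorem bivBracket_tensorQdef_volterraH {c : ZMod n → ℝ} (hc : c ∈ phaseSpace n) (i j : ℕ) :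
    bivBracket (tensorQdef n) (volterraH n i) (volterraH n j) c = 0 := by
  have hQ : ∀ i j, bivBracket (tensorQ n) (volterraH n i) (volterraH n j) c = 0 := fun i j => by
    rw [bivBracket_tensorQ_volterraH hc, bivBracket_tensorP_volterraH hc, neg_zero]
  have hX : ∀ i, ∑ a, fieldX n c a * partialDeriv a (volterraH n i) c = 0 := fun i => by
    rw [← fderiv_eq_sum_partialDeriv, fieldX, ← bivBracket_eq_fderiv, hQ]
  have h : bivBracket (tensorQdef n) (volterraH n i) (volterraH n j) c
      = bivBracket (tensorQ n) (volterraH n i) (volterraH n j) c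
        - ((∑ a, fieldX n c a * partialDeriv a (volterraH n i) c)
            * (∑ b, fieldZ n c b * partialDeriv b (volterraH n j) c)
          - (∑ a, fieldZ n c a * partialDeriv a (volterraH n i) c)
            * (∑ b, fieldX n c b * partialDeriv b (volterraH n j) c)) := by
    simp only [bivBracket, tensorQdef, wedge, Matrix.sub_apply, Matrix.of_apply,
      Finset.sum_mul_sum, ← Finset.sum_sub_distrib]
    exact Finset.sum_congr rfl fun a _ => Finset.sum_congr rfl fun b _ => by ring
  rw [h, hQ, hX, hX]
  simp

end Recursion

/-! ### The symplectic leaves of the quadratic tensor -/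

section Leaves

variable (n : ℕ) [NeZero n]

/-- The quadratic tensor in logarithmic coordinates, as a constant linear map. -/
def logTensorP : (ZMod n → ℝ) →ₗ[ℝ] (ZMod n → ℝ) where
  toFun u i := u (i + 1) - u (i - 1)
  map_add' u v := by funext i; simp only [Pi.add_apply]; ring
  map_smul' a u := by funext i; simp only [Pi.smul_apply, smul_eq_mul, RingHom.id_apply]; ring

/-- The direction of the symplectic leaves in logarithmic coordinates. -/
def leafDir : Submodule ℝ (ZMod n → ℝ) := LinearMap.range (logTensorP n)

/-- The set of the points of the phase space that differ from `x` by an element of `leafDir` in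
logarithmic coordinates. -/
def leafThrough (x : ZMod n → ℝ) : Set (ZMod n → ℝ) :=
  {y ∈ phaseSpace n | (fun i => Real.log (y i) - Real.log (x i)) ∈ leafDir n}

theorem exists_leafProj : ∃ q : (ZMod n → ℝ) →L[ℝ] (ZMod n → ℝ),
    (∀ v, q v ∈ leafDir n) ∧ ∀ v ∈ leafDir n, q v = v := by
  obtain ⟨p, hp⟩ := (leafDir n).subtype.exists_leftInverse_of_injective (leafDir n).ker_subtype
  refine ⟨LinearMap.toContinuousLinearMap ((leafDir n).subtype ∘ₗ p), fun v => (p v).2,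
    fun v hv => ?_⟩
  exact congrArg Subtype.val (LinearMap.congr_fun hp ⟨v, hv⟩)

variable {n}

theorem hamField_tensorP_eq (F : (ZMod n → ℝ) → ℝ) (c : ZMod n → ℝ) :
    hamField (tensorP n) F c = c * logTensorP n fun j => c j * partialDeriv j F c := by
  funext i
  rw [hamField_tensorP]
  rfl

theorem hasDerivWithinAt_log_coord {γ : ℝ → ZMod n → ℝ} {t : ℝ} {T : Set ℝ} {v : ZMod n → ℝ}
    (hγ : HasDerivWithinAt γ (γ t * v) T t) (hpos : γ t ∈ phaseSpace n) :
    HasDerivWithinAt (fun s i => Real.log (γ s i)) v T t := by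
  rw [hasDerivWithinAt_pi] at hγ ⊢
  intro i
  exact ((hγ i).log (hpos i).ne').congr_deriv
    (by rw [Pi.mul_apply, mul_div_cancel_left₀ _ (hpos i).ne'])

/-- The differences of the logarithmic coordinates along an integral curve of a Hamiltonian vector
field stay in `leafDir`, because a projector onto a complement kills their velocity. -/
theorem HamiltonianStep.log_sub_mem {x y : ZMod n → ℝ}
    (h : HamiltonianStep (phaseSpace n) (tensorP n) x y) :
    y ∈ phaseSpace n ∧ (fun i => Real.log (y i) - Real.log (x i)) ∈ leafDir n := by
  obtain ⟨F, γ, -, rfl, rfl, hγ⟩ := h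
  refine ⟨(hγ 1 (by simp)).1, ?_⟩
  obtain ⟨q, hq, hq'⟩ := exists_leafProj n
  set φ : ℝ → ZMod n → ℝ := fun t i => Real.log (γ t i)
  have hd : ∀ t ∈ Set.Icc (0 : ℝ) 1,
      HasDerivWithinAt (fun t => φ t - q (φ t)) 0 (Set.Icc 0 1) t := by
    intro t ht
    obtain ⟨hU, hder⟩ := hγ t ht
    rw [hamField_tensorP_eq] at hder
    have h1 := hasDerivWithinAt_log_coord hder hU
    have h2 := h1.sub (q.hasFDerivAt.comp_hasDerivWithinAt t h1)
    rwa [hq' _ ⟨_, rfl⟩, sub_self] at h2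
  have hc := constant_of_has_deriv_right_zero (fun t ht => (hd t ht).continuousWithinAt)
    (fun t ht => (hd t (Set.Ico_subset_Icc_self ht)).mono_of_mem_nhdsWithin
      (Icc_mem_nhdsGE_of_mem ht)) 1 (by simp)
  have he : (fun i => Real.log (γ 1 i) - Real.log (γ 0 i)) = q (φ 1) - q (φ 0) := by
    have : φ 1 - φ 0 = q (φ 1) - q (φ 0) := by
      linear_combination (exp := 1) hc
    rw [← this]; rfl
  rw [he]
  exact Submodule.sub_mem _ (hq _) (hq _)

theorem hasDerivAt_mul_exp (x r : ZMod n → ℝ) (t : ℝ) :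
    HasDerivAt (fun (t : ℝ) i => x i * Real.exp (t * r i))
      ((fun i => x i * Real.exp (t * r i)) * r) t := by
  rw [hasDerivAt_pi]
  intro i
  exact (((hasDerivAt_mul_const (x := t) (r i)).exp).const_mul (x i)).congr_deriv
    (by rw [Pi.mul_apply, mul_assoc])

theorem mul_exp_mem_phaseSpace {x : ZMod n → ℝ} (hx : x ∈ phaseSpace n) (r : ZMod n → ℝ) :
    (fun i => x i * Real.exp (r i)) ∈ phaseSpace n :=
  fun i => mul_pos (hx i) (Real.exp_pos _)

theorem log_mul_exp_sub {x : ZMod n → ℝ} (hx : x ∈ phaseSpace n) (r : ZMod n → ℝ) :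
    (fun i => Real.log (x i * Real.exp (r i)) - Real.log (x i)) = r := by
  funext i
  rw [Real.log_mul (hx i).ne' (Real.exp_pos _).ne', Real.log_exp]
  ring

theorem mul_exp_mem_leafThrough {x y : ZMod n → ℝ} (hy : y ∈ leafThrough n x) {r : ZMod n → ℝ}
    (hr : r ∈ leafDir n) : (fun i => y i * Real.exp (r i)) ∈ leafThrough n x := by
  refine ⟨mul_exp_mem_phaseSpace hy.1 r, ?_⟩
  have := Submodule.add_mem _ hr hy.2
  rw [← log_mul_exp_sub hy.1 r] at this
  convert this using 1
  funext i
  simp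

theorem mem_leafThrough_self {x : ZMod n → ℝ} (hx : x ∈ phaseSpace n) : x ∈ leafThrough n x :=
  ⟨hx, by simp only [sub_self]; exact (leafDir n).zero_mem⟩

theorem contDiffOn_sum_mul_log (u : ZMod n → ℝ) :
    ContDiffOn ℝ ∞ (fun c => ∑ j, u j * Real.log (c j)) (phaseSpace n) :=
  ContDiffOn.sum fun j _ => contDiffOn_const.mul
    (ContDiffOn.log (contDiff_apply ℝ ℝ j).contDiffOn fun _ hc => (hc j).ne')

theorem mul_partialDeriv_sum_mul_log (u : ZMod n → ℝ) {c : ZMod n → ℝ} (hc : c ∈ phaseSpace n)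
    (i : ZMod n) : c i * partialDeriv i (fun c => ∑ j, u j * Real.log (c j)) c = u i := by
  have : HasFDerivAt (fun c : ZMod n → ℝ => ∑ j, u j * Real.log (c j))
      (∑ j, u j • ((c j)⁻¹ • (ContinuousLinearMap.proj j : (ZMod n → ℝ) →L[ℝ] ℝ))) c :=
    HasFDerivAt.fun_sum fun j _ => ((hasFDerivAt_apply j c).log (hc j).ne').const_mul (u j)
  rw [partialDeriv, this.fderiv]
  have := (hc i).ne'
  simp [Pi.single_apply]
  field_simp

/-- The symplectic leaves are affine in logarithmic coordinates; two points of `leafThrough n x`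
are joined by the flow of a linear combination of the `log c_j`. -/
theorem IsSymplecticLeaf.exists_eq_leafThrough {S : Set (ZMod n → ℝ)}
    (hS : IsSymplecticLeaf (phaseSpace n) (tensorP n) S) :
    ∃ x ∈ phaseSpace n, S = leafThrough n x := by
  obtain ⟨x, hx, rfl⟩ := hS
  refine ⟨x, hx, Set.Subset.antisymm (fun y hy => ?_) fun y hy => ?_⟩
  · have hy : Relation.ReflTransGen (HamiltonianStep (phaseSpace n) (tensorP n)) x y := hy
    induction hy with
    | refl => exact mem_leafThrough_self hx
    | tail _ hstep ih =>
      obtain ⟨h1, h2⟩ := hstep.log_sub_mem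
      refine ⟨h1, ?_⟩
      convert Submodule.add_mem _ h2 (ih (by assumption)).2 using 1
      funext i
      simp
  · obtain ⟨hyU, u, hu⟩ := hy
    refine Relation.ReflTransGen.single ⟨fun c => ∑ j, u j * Real.log (c j),
      fun t i => x i * Real.exp (t * logTensorP n u i), contDiffOn_sum_mul_log u, by simp, ?_,
      fun t _ => ⟨mul_exp_mem_phaseSpace hx _, ?_⟩⟩
    · funext i
      simp only [hu, one_mul]
      rw [← Real.log_div (hyU i).ne' (hx i).ne',
        Real.exp_log (div_pos (hyU i) (hx i)), mul_div_cancel₀ _ (hx i).ne']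
    · rw [hamField_tensorP_eq]
      have hu' := fun j => mul_partialDeriv_sum_mul_log u
        (mul_exp_mem_phaseSpace hx fun i => t * logTensorP n u i) j
      rw [funext hu']
      exact (hasDerivAt_mul_exp x _ t).hasDerivWithinAt

/-- The tangent space of a leaf at `y` consists of the vectors `∑ r_i D_i` with `r ∈ leafDir`. -/
theorem tangentSpace_leafThrough (x : ZMod n → ℝ) {y : ZMod n → ℝ} (hy : y ∈ leafThrough n x) :
    tangentSpace (leafThrough n x) y = (leafDir n).map (LinearMap.mulLeft ℝ y) := by
  refine le_antisymm (Submodule.span_le.2 ?_) ?_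
  · rintro v ⟨γ, hγ, hγS, rfl, rfl⟩
    obtain ⟨q, hq, hq'⟩ := exists_leafProj n
    set φ : ℝ → ZMod n → ℝ := fun t i => Real.log (γ t i) - Real.log (x i)
    set r : ZMod n → ℝ := fun i => deriv γ 0 i / γ 0 i with hr
    have hv : deriv γ 0 = γ 0 * r := by
      funext i
      simp only [Pi.mul_apply, hr]
      rw [mul_div_cancel₀ _ (hy.1 i).ne']
    have h0 : HasDerivAt γ (γ 0 * r) 0 := hv ▸ (hγ.differentiable (by simp) 0).hasDerivAt
    have h1 : HasDerivAt φ r 0 := by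
      have := hasDerivWithinAt_univ.1 (hasDerivWithinAt_log_coord h0.hasDerivWithinAt hy.1)
      exact this.sub_const _
    have h2 : HasDerivAt φ (q r) 0 := by
      have := q.hasFDerivAt.comp_hasDerivAt 0 h1
      have he : (q ∘ φ) = φ := funext fun t => hq' _ (hγS t).2
      rwa [he] at this
    exact ⟨r, by rw [h1.unique h2]; exact hq r, hv.symm⟩
  · rintro _ ⟨r, hr, rfl⟩
    refine Submodule.subset_span ⟨fun t i => y i * Real.exp (t * r i), ?_, fun t => ?_, by simp, ?_⟩
    · rw [contDiff_pi]
      intro i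
      fun_prop
    · exact mul_exp_mem_leafThrough hy ((leafDir n).smul_mem t hr)
    · rw [(hasDerivAt_mul_exp y r 0).deriv]
      simp

theorem exists_isSmoothRetraction {x : ZMod n → ℝ} (hx : x ∈ phaseSpace n) :
    ∃ ρ, IsSmoothRetraction (phaseSpace n) (leafThrough n x) ρ := by
  obtain ⟨q, hq, hq'⟩ := exists_leafProj n
  refine ⟨fun c i => x i * Real.exp (q (fun i => Real.log (c i) - Real.log (x i)) i),
    isOpen_phaseSpace n, fun y hy => hy.1, ?_, fun c _ =>
      mul_exp_mem_leafThrough (mem_leafThrough_self hx) (hq _), fun c hc => ?_⟩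
  · have hlog : ContDiffOn ℝ ∞ (fun (c : ZMod n → ℝ) i => Real.log (c i) - Real.log (x i))
        (phaseSpace n) := contDiffOn_pi.2 fun i =>
      (ContDiffOn.log (contDiff_apply ℝ ℝ i).contDiffOn fun _ hc => (hc i).ne').sub
        contDiffOn_const
    have hql := q.contDiff.comp_contDiffOn hlog
    exact contDiffOn_pi.2 fun i => contDiffOn_const.mul ((contDiffOn_pi.1 hql i).exp)
  · funext i
    rw [hq' _ hc.2]
    beta_reduce
    rw [← Real.log_div (hc.1 i).ne' (hx i).ne',
        Real.exp_log (div_pos (hc.1 i) (hx i)), mul_div_cancel₀ _ (hx i).ne']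

theorem logTensorP_single (m : ZMod n) :
    logTensorP n (Pi.single m 1) = Pi.single (m - 1) 1 - Pi.single (m + 1) 1 := by
  funext i
  simp only [logTensorP, LinearMap.coe_mk, AddHom.coe_mk, Pi.sub_apply, Pi.single_apply,
    eq_sub_iff_add_eq, sub_eq_iff_eq_add]

theorem pairVecSub_mem_leafDir (m : ZMod n) : pairVecSub n m ∈ leafDir n := by
  have key : ∀ k : ℕ, pairVecSub n (1 + k) ∈ leafDir n := by
    intro k
    induction k with
    | zero =>
      have : pairVecSub n (1 + (0 : ℕ)) = 0 := by
        funext i; simpa using pairVecSub_one i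
      rw [this]; exact Submodule.zero_mem _
    | succ k ih =>
      have : pairVecSub n (1 + (k + 1 : ℕ)) = pairVecSub n (1 + k)
          - logTensorP n (Pi.single (1 + k) 1) := by
        rw [logTensorP_single]
        funext i
        have e : ∀ a b : ZMod n, kron n (a + 1) (b + 1) = kron n a b := by simp [kron]
        have e' : kron n (i + 1) (1 + (k : ZMod n)) = kron n i (1 + (k : ZMod n) - 1) := by
          simp [kron, ← eq_sub_iff_add_eq]
        simp only [pairVecSub, pairVec, Nat.cast_succ, ← add_assoc, e, e', Pi.sub_apply,
          Pi.single_apply]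
        simp only [kron]
        ring
      rw [this]
      exact Submodule.sub_mem _ ih ⟨_, rfl⟩
  have h := key (m - 1).val
  rwa [ZMod.natCast_zmod_val, add_sub_cancel] at h

theorem hamField_tensorP_mem_tangentSpace (x : ZMod n → ℝ) (y : leafThrough n x)
    (F : (ZMod n → ℝ) → ℝ) : hamField (tensorP n) F y ∈ tangentSpace (leafThrough n x) y := by
  rw [tangentSpace_leafThrough x y.2, hamField_tensorP_eq]
  exact ⟨_, ⟨_, rfl⟩, rfl⟩

theorem hamField_tensorQdef_mem_tangentSpace (x : ZMod n → ℝ) (y : leafThrough n x)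
    (F : (ZMod n → ℝ) → ℝ) : hamField (tensorQdef n) F y ∈ tangentSpace (leafThrough n x) y := by
  rw [tangentSpace_leafThrough x y.2]
  obtain ⟨y, hy⟩ := y
  set E : ZMod n → ℝ := fun m => ∑ j, pairVecSub n m j * (y j * partialDeriv j F y)
  refine ⟨∑ m, (y m • E (m + 1) • pairVecSub n m - y m • E m • pairVecSub n (m + 1)), ?_, ?_⟩
  · exact Submodule.sum_mem _ fun m _ => Submodule.sub_mem _
      (Submodule.smul_mem _ _ (Submodule.smul_mem _ _ (pairVecSub_mem_leafDir _)))
      (Submodule.smul_mem _ _ (Submodule.smul_mem _ _ (pairVecSub_mem_leafDir _)))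
  · funext i
    simp only [LinearMap.mulLeft_apply, Pi.mul_apply, Finset.sum_apply, Pi.sub_apply, Pi.smul_apply,
      smul_eq_mul, hamField, tensorQdef_apply hy.1, E, pairWedge, Finset.sum_mul, Finset.mul_sum,
      ← Finset.sum_sub_distrib]
    rw [Finset.sum_comm]
    exact Finset.sum_congr rfl fun j _ => Finset.sum_congr rfl fun m _ => by ring

end Leaves

/-! ### Casimir functions and the dimension of the leaves -/

section Casimirs

variable {n : ℕ} [NeZero n]

theorem mem_ker_logTensorP {v : ZMod n → ℝ} :
    v ∈ LinearMap.ker (logTensorP n) ↔ ∀ i, v (i + 1) = v (i - 1) := by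
  rw [LinearMap.mem_ker, funext_iff]
  exact forall_congr' fun i => sub_eq_zero

theorem apply_add_two_mul {v : ZMod n → ℝ} (hv : v ∈ LinearMap.ker (logTensorP n)) (a : ZMod n)
    (k : ℕ) : v (a + 2 * k) = v a := by
  induction k with
  | zero => simp
  | succ k ih =>
    have h := mem_ker_logTensorP.1 hv (a + 2 * k + 1)
    rw [add_sub_cancel_right, ih] at h
    rw [← h]
    congr 1
    push_cast
    ring

theorem finrank_ker_logTensorP_of_odd (hn : Odd n) :
    Module.finrank ℝ (LinearMap.ker (logTensorP n)) = 1 := by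
  let ev : LinearMap.ker (logTensorP n) →ₗ[ℝ] ℝ :=
    (LinearMap.proj 0) ∘ₗ (LinearMap.ker (logTensorP n)).subtype
  have hb : Function.Bijective ev := by
    constructor
    · rw [← LinearMap.ker_eq_bot, LinearMap.ker_eq_bot']
      rintro ⟨v, hv⟩ h0
      ext m
      have h0 : v 0 = 0 := h0
      obtain ⟨a, ha⟩ := hn
      -- `a + 1` is an inverse of `2` modulo `n = 2 * a + 1`.
      have h := apply_add_two_mul hv 0 ((a + 1) * m.val)
      have : (0 : ZMod n) + 2 * (((a + 1) * m.val : ℕ) : ZMod n) = m := by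
        have e : 2 * ((a + 1) * m.val) = n * m.val + m.val := by
          calc 2 * ((a + 1) * m.val) = (2 * a + 1) * m.val + m.val := by ring
            _ = n * m.val + m.val := by rw [← ha]
        rw [zero_add, ← Nat.cast_two (R := ZMod n), ← Nat.cast_mul, e]
        simp
      rw [this, h0] at h
      exact h
    · intro a
      exact ⟨⟨fun _ => a, mem_ker_logTensorP.2 fun _ => rfl⟩, rfl⟩
  rw [(LinearEquiv.ofBijective ev hb).finrank_eq, Module.finrank_self]

theorem finrank_ker_logTensorP_of_even (hn : Even n) :
    Module.finrank ℝ (LinearMap.ker (logTensorP n)) = 2 := by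
  let ev : LinearMap.ker (logTensorP n) →ₗ[ℝ] ℝ × ℝ :=
    ((LinearMap.proj 0).prod (LinearMap.proj 1)) ∘ₗ (LinearMap.ker (logTensorP n)).subtype
  have hev : ∀ v, ev v = (v.1 0, v.1 1) := fun _ => rfl
  have hb : Function.Bijective ev := by
    constructor
    · rw [← LinearMap.ker_eq_bot, LinearMap.ker_eq_bot']
      rintro ⟨v, hv⟩ h0
      obtain ⟨h0, h1⟩ : v 0 = 0 ∧ v 1 = 0 := by
        rw [hev] at h0
        exact ⟨congrArg Prod.fst h0, congrArg Prod.snd h0⟩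
      ext m
      change v m = 0
      obtain ⟨a, ha⟩ | ⟨a, ha⟩ := Nat.even_or_odd m.val
      · have : m = 0 + 2 * (a : ZMod n) := by
          rw [← ZMod.natCast_zmod_val m, ha]; push_cast; ring
        rw [this, apply_add_two_mul hv, h0]
      · have : m = 1 + 2 * (a : ZMod n) := by
          rw [← ZMod.natCast_zmod_val m, ha]; push_cast; ring
        rw [this, apply_add_two_mul hv, h1]
    · rintro ⟨a, b⟩
      let p : ZMod n →+* ZMod 2 := ZMod.castHom hn.two_dvd (ZMod 2)
      have hp : ∀ i, p (i + 1) = p (i - 1) := fun i => by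
        rw [map_add, map_sub, map_one, sub_eq_add_neg]
        congr 1
      refine ⟨⟨fun i => if p i = 0 then a else b, mem_ker_logTensorP.2 fun i => by
        simp only [hp]⟩, ?_⟩
      rw [hev]
      simp
  rw [(LinearEquiv.ofBijective ev hb).finrank_eq, Module.finrank_prod, Module.finrank_self]

theorem finrank_leafDir : Module.finrank ℝ (leafDir n) = 2 * ((n - 1) / 2) := by
  have h := (logTensorP n).finrank_range_add_finrank_ker
  rw [Module.finrank_fintype_fun_eq_card, ZMod.card] at h
  change Module.finrank ℝ (leafDir n) + _ = n at h
  have hn0 := NeZero.ne n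
  obtain hn | hn := Nat.even_or_odd n
  · rw [finrank_ker_logTensorP_of_even hn] at h
    obtain ⟨a, ha⟩ := hn
    omega
  · rw [finrank_ker_logTensorP_of_odd hn] at h
    obtain ⟨a, ha⟩ := hn
    omega

theorem finrank_tangentSpace_leafThrough (x : ZMod n → ℝ) (y : leafThrough n x) :
    Module.finrank ℝ (tangentSpace (leafThrough n x) y) = 2 * ((n - 1) / 2) := by
  rw [tangentSpace_leafThrough x y.2, ← finrank_leafDir (n := n)]
  refine (Submodule.equivMapOfInjective _ (fun r r' h => ?_) _).finrank_eq.symm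
  funext i
  exact mul_left_cancel₀ (y.2.1 i).ne' (congrFun h i)

/-- `leafDir` is orthogonal to the kernel of the antisymmetric map it is the range of. -/
theorem sum_mul_eq_zero_of_mem_ker {v r : ZMod n → ℝ} (hv : v ∈ LinearMap.ker (logTensorP n))
    (hr : r ∈ leafDir n) : ∑ l, v l * r l = 0 := by
  obtain ⟨u, rfl⟩ := hr
  have h1 : ∑ l, v l * u (l + 1) = ∑ l, v (l - 1) * u l := by
    rw [← Equiv.sum_comp (Equiv.addRight (1 : ZMod n)) fun l => v (l - 1) * u l]
    simp
  have h2 : ∑ l, v l * u (l - 1) = ∑ l, v (l + 1) * u l := by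
    rw [← Equiv.sum_comp (Equiv.subRight (1 : ZMod n)) fun l => v (l + 1) * u l]
    simp
  have : ∀ l, v l * logTensorP n u l = v l * u (l + 1) - v l * u (l - 1) := fun l => mul_sub _ _ _
  simp only [this, Finset.sum_sub_distrib, h1, h2, mem_ker_logTensorP.1 hv, sub_self]

/-- The monomial of a set of sites that is invariant under translation by two sites is a Casimir
function. -/
theorem prod_eq_prod_of_mem_leafThrough {s : Finset (ZMod n)}
    (hs : ∀ l, l + 1 ∈ s ↔ l - 1 ∈ s) {x y z : ZMod n → ℝ} (hx : x ∈ phaseSpace n)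
    (hy : y ∈ leafThrough n x) (hz : z ∈ leafThrough n x) : ∏ l ∈ s, y l = ∏ l ∈ s, z l := by
  have key : ∀ y ∈ leafThrough n x, ∏ l ∈ s, y l = ∏ l ∈ s, x l := by
    intro y hy
    have hv : (fun l => if l ∈ s then (1 : ℝ) else 0) ∈ LinearMap.ker (logTensorP n) :=
      mem_ker_logTensorP.2 fun i => by simp only [hs]
    have h := sum_mul_eq_zero_of_mem_ker hv hy.2
    simp only [ite_mul, one_mul, zero_mul, Finset.sum_ite_mem, Finset.univ_inter,
      Finset.sum_sub_distrib] at h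
    rw [← Real.log_prod fun l _ => (hy.1 l).ne', ← Real.log_prod fun l _ => (hx l).ne',
      sub_eq_zero] at h
    exact Real.log_injOn_pos (Finset.prod_pos fun l _ => hy.1 l) (Finset.prod_pos fun l _ => hx l) h
  rw [key y hy, key z hz]

/-- A totally disconnected set that fills half of the lattice consists of every second site. -/
theorem add_one_mem_iff_of_mem_indepSets {i : ℕ} (hi : n = 2 * i) {s : Finset (ZMod n)}
    (hs : s ∈ indepSets n i) (l : ZMod n) : l + 1 ∈ s ↔ l - 1 ∈ s := by
  obtain ⟨hcard, hind⟩ := mem_indepSets.1 hs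
  have hdisj : Disjoint s (s.map (Equiv.addRight (1 : ZMod n)).toEmbedding) := by
    rw [Finset.disjoint_left]
    intro a ha h
    obtain ⟨b, hb, rfl⟩ := Finset.mem_map.1 h
    exact hind b hb ha
  have hU : s ∪ s.map (Equiv.addRight (1 : ZMod n)).toEmbedding = Finset.univ := by
    rw [← Finset.card_eq_iff_eq_univ, Finset.card_union_of_disjoint hdisj, Finset.card_map, hcard,
      ZMod.card]
    omega
  have key : ∀ a, a + 1 ∈ s ↔ a ∉ s := by
    refine fun a => ⟨fun h ha => hind a ha h, fun h => ?_⟩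
    have := hU ▸ Finset.mem_univ (a + 1)
    rcases Finset.mem_union.1 this with h' | h'
    · exact h'
    · obtain ⟨b, hb, hab⟩ := Finset.mem_map.1 h'
      have : b = a := by simpa using hab
      exact absurd (this ▸ hb) h
  have := key (l - 1)
  rw [sub_add_cancel] at this
  rw [key, this, not_not]

theorem volterraH_eq_of_mem_leafThrough {i : ℕ} (hi : i ≤ n / 2) (hi' : i = 0 ∨ (n - 1) / 2 < i)
    {x y z : ZMod n → ℝ} (hx : x ∈ phaseSpace n) (hy : y ∈ leafThrough n x)
    (hz : z ∈ leafThrough n x) : volterraH n i y = volterraH n i z := by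
  have hprod : ∏ l, y l = ∏ l, z l :=
    prod_eq_prod_of_mem_leafThrough (by simp) hx hy hz
  rcases hi' with rfl | hi'
  · rw [volterraH_zero, volterraH_zero, hprod]
  · have hJ : volterraJ n i y = volterraJ n i z := Finset.sum_congr rfl fun s hs =>
      prod_eq_prod_of_mem_leafThrough (add_one_mem_iff_of_mem_indepSets (by omega) hs) hx hy hz
    rw [volterraH, volterraH, hJ, hprod]

end Casimirs

/-! ### Functional independence -/

section Independence

theorem linearIndependent_of_det_ne_zero {V : Type*} [AddCommGroup V] [Module ℝ V] {k : ℕ}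
    (φ : Fin k → V →ₗ[ℝ] ℝ) (v : Fin k → V)
    (h : (Matrix.of fun i j => φ i (v j)).det ≠ 0) : LinearIndependent ℝ φ :=
  LinearIndependent.of_comp (LinearMap.pi fun j => LinearMap.applyₗ (v j))
    (Matrix.linearIndependent_rows_of_det_ne_zero h)

variable (n : ℕ) [NeZero n]

/-- The odd sites `1, 3, 5, …`. -/
def oddSite (j : ℕ) : ZMod n := 1 + ((2 * j : ℕ) : ZMod n)

/-- The first `i` odd sites. -/
def oddSites (i : ℕ) : Finset (ZMod n) := (Finset.range i).image (oddSite n)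

/-- The direction in logarithmic coordinates along which the monomials of the sets `oddSites n i`
with `i ≤ (n - 1) / 2` dominate all other monomials of the same degree. -/
def oddWeight : ZMod n → ℝ :=
  ∑ j ∈ Finset.range ((n - 1) / 2), (((n - 1) / 2 : ℕ) - j : ℝ) •
    (Pi.single (oddSite n j) 1 - Pi.single (oddSite n ((n - 1) / 2)) 1)

variable {n}

theorem natCast_inj_of_lt {a b : ℕ} (ha : a < n) (hb : b < n) (h : (a : ZMod n) = b) : a = b :=
  Nat.ModEq.eq_of_lt_of_lt ((ZMod.natCast_eq_natCast_iff a b n).1 h) ha hb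

theorem oddSite_inj {a b : ℕ} (ha : a ≤ (n - 1) / 2) (hb : b ≤ (n - 1) / 2) :
    oddSite n a = oddSite n b ↔ a = b := by
  refine ⟨fun h => ?_, fun h => h ▸ rfl⟩
  have hn := NeZero.pos n
  have := natCast_inj_of_lt (n := n) (by omega) (by omega) (add_left_cancel h)
  omega

theorem oddSite_mem_oddSites {i j : ℕ} (hi : i ≤ (n - 1) / 2) (hj : j ≤ (n - 1) / 2) :
    oddSite n j ∈ oddSites n i ↔ j < i := by
  simp only [oddSites, Finset.mem_image, Finset.mem_range]
  refine ⟨fun ⟨a, ha, h⟩ => ?_, fun h => ⟨j, h, rfl⟩⟩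
  rwa [← (oddSite_inj (by omega) hj).1 h]

theorem oddSites_mem_indepSets {i : ℕ} (hi : i ≤ (n - 1) / 2) : oddSites n i ∈ indepSets n i := by
  refine mem_indepSets.2 ⟨?_, ?_⟩
  · rw [oddSites, Finset.card_image_of_injOn, Finset.card_range]
    intro a ha b hb h
    simp only [Finset.coe_range, Set.mem_Iio] at ha hb
    exact (oddSite_inj (by omega) (by omega)).1 h
  · intro l hl hl'
    obtain ⟨a, ha, rfl⟩ := Finset.mem_image.1 hl
    obtain ⟨b, hb, h⟩ := Finset.mem_image.1 hl'
    rw [Finset.mem_range] at ha hb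
    have h' : ((2 * b : ℕ) : ZMod n) = ((2 * a + 1 : ℕ) : ZMod n) := by
      rw [oddSite, oddSite, add_assoc] at h
      rw [add_left_cancel h]; push_cast; rfl
    have := natCast_inj_of_lt (n := n) (by omega) (by omega) h'
    omega

theorem single_oddSite_sub_succ (j : ℕ) :
    (Pi.single (oddSite n j) 1 - Pi.single (oddSite n (j + 1)) 1 : ZMod n → ℝ)
      = logTensorP n (Pi.single (oddSite n j + 1) 1) := by
  have : oddSite n (j + 1) = oddSite n j + 1 + 1 := by
    simp only [oddSite]; push_cast; ring
  rw [logTensorP_single, add_sub_cancel_right, this]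

theorem oddWeight_mem_leafDir : oddWeight n ∈ leafDir n := by
  have h0 : ∀ j, (Pi.single (oddSite n 0) 1 - Pi.single (oddSite n j) 1 : ZMod n → ℝ)
      ∈ leafDir n := by
    intro j
    induction j with
    | zero => rw [sub_self]; exact Submodule.zero_mem _
    | succ j ih =>
      have := Submodule.add_mem _ ih ⟨_, (single_oddSite_sub_succ j).symm⟩
      rwa [sub_add_sub_cancel] at this
  refine Submodule.sum_mem _ fun j _ => Submodule.smul_mem _ _ ?_
  have := Submodule.sub_mem _ (h0 ((n - 1) / 2)) (h0 j)
  rwa [sub_sub_sub_cancel_left] at this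

theorem oddWeight_apply (l : ZMod n) :
    oddWeight n l = ∑ j ∈ Finset.range ((n - 1) / 2), (((n - 1) / 2 : ℕ) - j : ℝ) *
      ((if l = oddSite n j then 1 else 0) - if l = oddSite n ((n - 1) / 2) then 1 else 0) := by
  simp [oddWeight, Finset.sum_apply, Pi.single_apply]

theorem oddWeight_oddSite {a : ℕ} (ha : a < (n - 1) / 2) :
    oddWeight n (oddSite n a) = ((n - 1) / 2 : ℕ) - a := by
  rw [oddWeight_apply, if_neg (fun h => ha.ne ((oddSite_inj ha.le le_rfl).1 h)),
    Finset.sum_eq_single a]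
  · simp
  · intro b hb hba
    rw [if_neg (fun h => hba ((oddSite_inj ha.le (Finset.mem_range.1 hb).le).1 h).symm)]
    simp
  · simp [ha]

theorem oddWeight_nonpos {l : ZMod n} (hl : ∀ a < (n - 1) / 2, l ≠ oddSite n a) :
    oddWeight n l ≤ 0 := by
  rw [oddWeight_apply]
  refine Finset.sum_nonpos fun j hj => ?_
  have hj := Finset.mem_range.1 hj
  rw [if_neg (hl j hj), zero_sub]
  have h1 : (0 : ℝ) ≤ ((n - 1) / 2 : ℕ) - j := sub_nonneg.2 (by exact_mod_cast hj.le)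
  have h2 : (0 : ℝ) ≤ if l = oddSite n ((n - 1) / 2) then 1 else 0 := by split_ifs <;> norm_num
  nlinarith

/-- Among the sets of `i` sites, `oddSites n i` is the unique one of maximal weight: it consists
of the sites of weight at least `(n - 1) / 2 - i + 1`. -/
theorem sum_oddWeight_lt {i : ℕ} (hi : i ≤ (n - 1) / 2) {s : Finset (ZMod n)}
    (hs : s.card = i) (hne : s ≠ oddSites n i) :
    ∑ l ∈ s, oddWeight n l < ∑ l ∈ oddSites n i, oddWeight n l := by
  have hT := (mem_indepSets.1 (oddSites_mem_indepSets hi)).1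
  set T := oddSites n i
  have hcard : (s \ T).card = (T \ s).card := by
    have h1 := Finset.card_sdiff_add_card_inter s T
    have h2 := Finset.card_sdiff_add_card_inter T s
    rw [Finset.inter_comm] at h2
    omega
  have hnonempty : (s \ T).Nonempty := by
    rw [Finset.sdiff_nonempty]
    exact fun h => hne (Finset.eq_of_subset_of_card_le h (by omega))
  set θ : ℝ := ((n - 1) / 2 : ℕ) - i + 1 with hθ
  have hlow : ∀ l ∈ s \ T, oddWeight n l < θ := by
    intro l hl
    have hlT := (Finset.mem_sdiff.1 hl).2
    have hi' : (i : ℝ) ≤ ((n - 1) / 2 : ℕ) := by exact_mod_cast hi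
    by_cases h : ∃ a < (n - 1) / 2, l = oddSite n a
    · obtain ⟨a, ha, rfl⟩ := h
      rw [oddSite_mem_oddSites hi ha.le, not_lt] at hlT
      rw [oddWeight_oddSite ha, hθ]
      have : (i : ℝ) ≤ a := by exact_mod_cast hlT
      linarith
    · push Not at h
      have := oddWeight_nonpos h
      linarith
  have hhigh : ∀ l ∈ T \ s, θ ≤ oddWeight n l := by
    intro l hl
    obtain ⟨a, ha, rfl⟩ := Finset.mem_image.1 (Finset.mem_sdiff.1 hl).1
    have ha := Finset.mem_range.1 ha
    rw [oddWeight_oddSite (by omega), hθ]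
    have : (a : ℝ) + 1 ≤ i := by exact_mod_cast ha
    linarith
  have h1 : ∑ l ∈ s \ T, oddWeight n l < (s \ T).card • θ := by
    rw [← Finset.sum_const]
    exact Finset.sum_lt_sum_of_nonempty hnonempty hlow
  have h2 : (T \ s).card • θ ≤ ∑ l ∈ T \ s, oddWeight n l := Finset.card_nsmul_le_sum _ _ _ hhigh
  have h3 := Finset.sum_sdiff_sub_sum_sdiff (s₁ := s) (s₂ := T) (f := oddWeight n)
  rw [hcard] at h1
  linarith

/-- The point at time `t` on the curve through `y` with logarithmic velocity `oddWeight n`. -/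
def oddCurve (y : ZMod n → ℝ) (t : ℝ) : ZMod n → ℝ := fun l => y l * Real.exp (t * oddWeight n l)

theorem prod_oddCurve (y : ZMod n → ℝ) (t : ℝ) (s : Finset (ZMod n)) :
    ∏ l ∈ s, oddCurve y t l = (∏ l ∈ s, y l) * Real.exp (t * ∑ l ∈ s, oddWeight n l) := by
  simp only [oddCurve, Finset.prod_mul_distrib, ← Real.exp_sum, Finset.mul_sum]

/-- After rescaling, only the dominant monomial survives in the limit. -/
theorem tendsto_eulerJ_oddCurve (y : ZMod n → ℝ) {i : ℕ} (hi : i ≤ (n - 1) / 2) (a : ZMod n) :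
    Filter.Tendsto (fun t => Real.exp (-(t * ∑ l ∈ oddSites n i, oddWeight n l))
      * eulerJ i a (oddCurve y t)) Filter.atTop
      (nhds (if a ∈ oddSites n i then ∏ l ∈ oddSites n i, y l else 0)) := by
  have hlim : (if a ∈ oddSites n i then ∏ l ∈ oddSites n i, y l else 0)
      = ∑ s ∈ indepSets n i with a ∈ s, if s = oddSites n i then ∏ l ∈ s, y l else 0 := by
    rw [Finset.sum_ite_eq']
    simp [oddSites_mem_indepSets hi]
  rw [hlim]
  refine Filter.Tendsto.congr (fun t => (Finset.mul_sum _ _ _).symm) ?_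
  refine tendsto_finsetSum _ fun s hs => ?_
  have hs := (mem_indepSets.1 (Finset.mem_filter.1 hs).1).1
  have h : ∀ t, Real.exp (-(t * ∑ l ∈ oddSites n i, oddWeight n l)) * ∏ l ∈ s, oddCurve y t l
      = (∏ l ∈ s, y l) * Real.exp (-(t * (∑ l ∈ oddSites n i, oddWeight n l
        - ∑ l ∈ s, oddWeight n l))) := by
    intro t
    rw [prod_oddCurve, mul_left_comm, ← Real.exp_add]
    congr 2
    ring
  simp only [h]
  split_ifs with hsT
  · subst hsT
    simp
  · have hpos := sub_pos.2 (sum_oddWeight_lt hi hs hsT)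
    have := Real.tendsto_exp_neg_atTop_nhds_zero.comp (Filter.tendsto_id.atTop_mul_const hpos)
    simpa using this.const_mul (∏ l ∈ s, y l)

variable (n) in
/-- The derivatives of `J_1, …, J_k` along the vector fields `D_{2j-1} - D_{2j+1}`, `1 ≤ j ≤ k`,
where `k = (n - 1) / 2`; both indices are shifted by one. -/
def oddMinor (c : ZMod n → ℝ) : Matrix (Fin ((n - 1) / 2)) (Fin ((n - 1) / 2)) ℝ :=
  Matrix.of fun i j => eulerJ (i + 1) (oddSite n j) c - eulerJ (i + 1) (oddSite n (j + 1)) c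

theorem exists_det_oddMinor_ne_zero {y : ZMod n → ℝ} (hy : y ∈ phaseSpace n) :
    ∃ t, (oddMinor n (oddCurve y t)).det ≠ 0 := by
  by_contra! h
  set C : Fin ((n - 1) / 2) → ℝ := fun i => ∏ l ∈ oddSites n (i + 1), y l
  set e : ℝ → Fin ((n - 1) / 2) → ℝ := fun t i =>
    Real.exp (-(t * ∑ l ∈ oddSites n (i + 1), oddWeight n l))
  have hlim : Filter.Tendsto (fun t => Matrix.of fun i j => e t i * oddMinor n (oddCurve y t) i j)
      Filter.atTop (nhds (Matrix.diagonal C)) := by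
    refine tendsto_pi_nhds.2 fun i => tendsto_pi_nhds.2 fun j => ?_
    have h1 := tendsto_eulerJ_oddCurve y (i := i + 1) (by omega) (oddSite n j)
    have h2 := tendsto_eulerJ_oddCurve y (i := i + 1) (by omega) (oddSite n (j + 1))
    convert h1.sub h2 using 1
    · funext t
      exact mul_sub _ _ _
    · congr 1
      rw [Matrix.diagonal_apply]
      simp only [oddSite_mem_oddSites (n := n) (i := i + 1) (by omega) j.2.le,
        oddSite_mem_oddSites (n := n) (i := i + 1) (j := j + 1) (by omega) (by omega), Fin.ext_iff]
      rcases lt_trichotomy (i : ℕ) j with hij | hij | hij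
      · rw [if_neg (by omega), if_neg (by omega), if_neg (by omega), sub_zero]
      · rw [if_pos hij, if_pos (by omega), if_neg (by omega), sub_zero]
      · rw [if_neg (by omega), if_pos (by omega), if_pos (by omega), sub_self]
  have hdet := (continuous_id.matrix_det.tendsto (Matrix.diagonal C)).comp hlim
  have hzero : (fun M : Matrix (Fin ((n - 1) / 2)) (Fin ((n - 1) / 2)) ℝ => (id M).det)
      ∘ (fun t => Matrix.of fun i j => e t i * oddMinor n (oddCurve y t) i j) = fun _ => 0 := by
    funext t
    simp only [Function.comp, id]
    rw [Matrix.det_mul_column, h, mul_zero]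
  rw [hzero, id, Matrix.det_diagonal] at hdet
  have := tendsto_nhds_unique hdet tendsto_const_nhds
  exact (Finset.prod_pos fun i _ => Finset.prod_pos fun l _ => hy l).ne' this

theorem analyticAt_det_oddMinor (y : ZMod n → ℝ) (t : ℝ) :
    AnalyticAt ℝ (fun t => (oddMinor n (oddCurve y t)).det) t := by
  have hE : ∀ i a, AnalyticAt ℝ (fun t => eulerJ i a (oddCurve y t)) t := by
    intro i a
    simp only [eulerJ, prod_oddCurve]
    exact Finset.analyticAt_fun_sum _ fun s _ => by fun_prop
  simp only [Matrix.det_apply']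
  exact Finset.analyticAt_fun_sum _ fun σ _ => analyticAt_const.mul
    (Finset.analyticAt_fun_prod _ fun i _ => (hE _ _).sub (hE _ _))

/-- Zeros of an analytic function on a line are isolated unless it vanishes identically, so the
points where the minor does not vanish accumulate at every point. -/
theorem frequently_det_oddMinor_ne_zero {y : ZMod n → ℝ} (hy : y ∈ phaseSpace n) :
    ∃ᶠ t in nhds 0, (oddMinor n (oddCurve y t)).det ≠ 0 := by
  intro h
  obtain ⟨t, ht⟩ := exists_det_oddMinor_ne_zero hy
  have hA : AnalyticOnNhd ℝ (fun t => (oddMinor n (oddCurve y t)).det) Set.univ :=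
    fun t _ => analyticAt_det_oddMinor y t
  refine ht (hA.eqOn_zero_of_preconnected_of_eventuallyEq_zero isPreconnected_univ
    (Set.mem_univ 0) ?_ (Set.mem_univ t))
  filter_upwards [h] with s hs using not_not.1 hs

theorem continuous_det_oddMinor : Continuous fun c => (oddMinor n c).det := by
  refine Continuous.matrix_det (continuous_matrix fun i j => ?_)
  exact Continuous.sub
    (continuous_finsetSum _ fun s _ => continuous_finsetProd _ fun l _ => continuous_apply l)
    (continuous_finsetSum _ fun s _ => continuous_finsetProd _ fun l _ => continuous_apply l)

theorem dense_det_oddMinor_ne_zero (x : ZMod n → ℝ) :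
    Dense {y : leafThrough n x | (oddMinor n y).det ≠ 0} := by
  intro y
  rw [mem_closure_iff_frequently]
  let p : ℝ → leafThrough n x := fun t => ⟨oddCurve y t,
    mul_exp_mem_leafThrough y.2 ((leafDir n).smul_mem t oddWeight_mem_leafDir)⟩
  have hp : Filter.Tendsto p (nhds 0) (nhds y) := by
    have hc : Continuous p := Continuous.subtype_mk
      (continuous_pi fun l => by simp only [oddCurve]; fun_prop) _
    have h0 : p 0 = y := Subtype.ext (funext fun l => by simp [p, oddCurve])
    exact h0 ▸ hc.tendsto 0
  exact hp.frequently (frequently_det_oddMinor_ne_zero y.2.1)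

theorem fderiv_volterraH_single_sub {c : ZMod n → ℝ} (hc : c ∈ phaseSpace n) (i : ℕ)
    (a b : ZMod n) : fderiv ℝ (volterraH n i) c (c * (Pi.single a 1 - Pi.single b 1))
      = volterraH n 0 c * (eulerJ i a c - eulerJ i b c) := by
  have h : ∀ l, (c * (Pi.single a 1 - Pi.single b 1) : ZMod n → ℝ) l
      * partialDeriv l (volterraH n i) c
      = ((if l = a then 1 else 0) - if l = b then 1 else 0) *
        (volterraH n 0 c * (eulerJ i l c - volterraJ n i c / 2)) := by
    intro l
    rw [← mul_partialDeriv_volterraH hc, Pi.mul_apply, Pi.sub_apply, Pi.single_apply,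
      Pi.single_apply]
    ring
  rw [fderiv_eq_sum_partialDeriv]
  simp only [h, sub_mul, ite_mul, one_mul, zero_mul, Finset.sum_sub_distrib, Finset.sum_ite_eq',
    Finset.mem_univ, if_true]
  ring

end Independence

/-! ### The restricted pencil on a symplectic leaf -/

section Restricted

variable {n : ℕ} [NeZero n]

/-- The quadratic tensor is nondegenerate on its leaves: the Hamiltonian vector fields of the
functions `∑ u_j log c_j` span the tangent spaces. -/
theorem isNondegenerate_retractBracket {x : ZMod n → ℝ} {ρ : (ZMod n → ℝ) → ZMod n → ℝ}
    (hρ : IsSmoothRetraction (phaseSpace n) (leafThrough n x) ρ) :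
    IsNondegenerate (retractBracket hρ (isPoissonTensor_tensorP (n := n)).smooth) := by
  intro y f hf
  have hext := hρ.contDiffOn_extendBy f
  have hres := retractBracket_restrictsTo hρ isPoissonTensor_tensorP.smooth
    isPoissonTensor_tensorP.antisymm (hamField_tensorP_mem_tangentSpace x)
  refine LinearMap.ext fun v => ?_
  rw [differential_eq f y _ _ (isOpen_phaseSpace n) y.2.1 hext
    (fun z _ => (hρ.extendBy_apply _ z).symm) v]
  obtain ⟨v, hv⟩ := v
  rw [tangentSpace_leafThrough x y.2] at hv
  obtain ⟨_, ⟨u, rfl⟩, rfl⟩ := hv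
  have h := hres.2 _ _ hext (contDiffOn_sum_mul_log u) f
    (restrictSmooth hρ.isOpen hρ.subset (contDiffOn_sum_mul_log u))
    (fun z => (hρ.extendBy_apply _ z).symm) (fun _ => rfl) y
  rw [hf, bivBracket_eq_fderiv, hamField_tensorP_eq,
    funext fun j => mul_partialDeriv_sum_mul_log u y.2.1 j] at h
  exact h.symm

theorem linearIndependent_differential_volterraH {x : ZMod n → ℝ} {y : leafThrough n x}
    (hy : (oddMinor n y).det ≠ 0) (f : Fin ((n - 1) / 2) → smoothFunctions (leafThrough n x))
    (hf : ∀ i (z : leafThrough n x), (f i : leafThrough n x → ℝ) z = volterraH n (i + 1) z) :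
    LinearIndependent ℝ fun i => differential (f i) y := by
  have hmem : ∀ j,
      (y : ZMod n → ℝ) * (Pi.single (oddSite n j) 1 - Pi.single (oddSite n (j + 1)) 1)
      ∈ tangentSpace (leafThrough n x) y := fun j => by
    rw [tangentSpace_leafThrough x y.2, single_oddSite_sub_succ]
    exact ⟨_, ⟨_, rfl⟩, rfl⟩
  refine linearIndependent_of_det_ne_zero _ (fun j : Fin ((n - 1) / 2) => ⟨_, hmem j⟩) ?_
  have h : (Matrix.of fun i j : Fin ((n - 1) / 2) => differential (f i) y ⟨_, hmem j⟩)
      = volterraH n 0 y • oddMinor n y := by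
    ext i j
    rw [Matrix.of_apply, differential_eq (f i) y _ _ (isOpen_phaseSpace n) y.2.1
      (contDiffOn_volterraH (i + 1)) (fun z _ => hf i z), fderiv_volterraH_single_sub y.2.1]
    rfl
  rw [h, Matrix.det_smul]
  exact mul_ne_zero (pow_ne_zero _ (volterraH_zero_pos y.2.1).ne') hy

end Restricted

end

theorem mainTheorem2 (n : ℕ) [NeZero n] :
    IsPoissonPencilTensor (phaseSpace n) (tensorP n) (tensorQdef n) ∧
    (∀ i ≤ n / 2, ∀ j ≤ n / 2, ∀ c ∈ phaseSpace n,
      bivBracket (tensorP n) (volterraH n i) (volterraH n j) c = 0 ∧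
      bivBracket (tensorQdef n) (volterraH n i) (volterraH n j) c = 0) ∧
    ∀ S : Set (ZMod n → ℝ), IsSymplecticLeaf (phaseSpace n) (tensorP n) S →
      ∃ brP brQ : smoothFunctions S →ₗ[ℝ] smoothFunctions S →ₗ[ℝ] smoothFunctions S,
        RestrictsTo (phaseSpace n) (tensorP n) S brP ∧
        RestrictsTo (phaseSpace n) (tensorQdef n) S brQ ∧
        IsPoissonPencil brP brQ ∧
        ∃ Hhat : ℕ → smoothFunctions S,
          (∀ i, ∀ x : S, (Hhat i : S → ℝ) x = volterraH n i x) ∧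
          IsBiLagrangianFoliation brP brQ (fun i : Fin ((n - 1) / 2) => Hhat (i + 1)) ∧
          ∀ i ≤ n / 2, (i = 0 ∨ (n - 1) / 2 < i) →
            ∀ x y : S, (Hhat i : S → ℝ) x = (Hhat i : S → ℝ) y := by
  refine ⟨isPoissonPencilTensor_volterra, fun i _ j _ c hc =>
    ⟨bivBracket_tensorP_volterraH hc i j, bivBracket_tensorQdef_volterraH hc i j⟩, ?_⟩
  intro S hS
  obtain ⟨x, hx, rfl⟩ := hS.exists_eq_leafThrough
  obtain ⟨ρ, hρ⟩ := exists_isSmoothRetraction hx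
  have hpencil := isPoissonPencilTensor_volterra (n := n)
  -- The deformed tensor itself is the member `ν = 0` of the pencil.
  have hQ : IsPoissonTensor (phaseSpace n) (tensorQdef n) := by
    simpa using hpencil.pencil 0
  have hresP := retractBracket_restrictsTo hρ hpencil.base.smooth hpencil.base.antisymm
    (hamField_tensorP_mem_tangentSpace x)
  have hresQ := retractBracket_restrictsTo hρ hQ.smooth hQ.antisymm
    (hamField_tensorQdef_mem_tangentSpace x)
  have hH := contDiffOn_volterraH (n := n)
  refine ⟨retractBracket hρ hpencil.base.smooth, retractBracket hρ hQ.smooth, hresP, hresQ,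
    retractBracket_isPoissonPencil hρ hpencil hQ.smooth (hamField_tensorP_mem_tangentSpace x)
      (hamField_tensorQdef_mem_tangentSpace x),
    fun i => restrictSmooth hρ.isOpen hρ.subset (hH i), fun _ _ => rfl,
    ⟨isNondegenerate_retractBracket hρ, finrank_tangentSpace_leafThrough x,
      ⟨{y | (oddMinor n y).det ≠ 0}, ?_, dense_det_oddMinor_ne_zero x, fun y hy =>
        linearIndependent_differential_volterraH hy _ fun _ _ => rfl⟩,
      fun i j => Subtype.ext (funext fun y => ?_), fun i j => Subtype.ext (funext fun y => ?_)⟩,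
    fun i hi hi' y z => volterraH_eq_of_mem_leafThrough hi hi' hx y.2 z.2⟩
  · exact isOpen_ne_fun (continuous_det_oddMinor.comp continuous_subtype_val) continuous_const
  · exact (hresP.2 _ _ (hH _) (hH _) _ _ (fun _ => rfl) (fun _ => rfl) y).trans
      (bivBracket_tensorP_volterraH y.2.1 _ _)
  · exact (hresQ.2 _ _ (hH _) (hH _) _ _ (fun _ => rfl) (fun _ => rfl) y).trans
      (bivBracket_tensorQdef_volterraH y.2.1 _ _)
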